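/- Let $\theta_1,\theta_2,\dots$ be nonnegative real numbers with $\theta_n\to\theta$ as $n\to\infty$, where $0<\theta<\infty$. For a permutation $\sigma$ of $\{1,\dots,n\}$ let $R_j(\sigma)$ be the number of cycles of length $j$ of $\sigma$ (fixed points being cycles of length one), and let $K(\sigma)=\sum_{j=1}^n R_j(\sigma)$ be the total number of cycles. Put $$h_n=\frac1{n!}\sum_{\sigma\in S_n}\prod_{j\ge1}\theta_j^{R_j(\sigma)},\qquad \mathbb P_n(\sigma)=\frac1{n!\,h_n}\prod_{j\ge1}\theta_j^{R_j(\sigma)}\quad(\sigma\in S_n),$$ and let $\mathbb E_n$ denote expectation with respect to $\mathbb P_n$. Let $L^{(1)}\ge L^{(2)}\ge\dots$ be the cycle lengths of $\sigma$ in nonincreasing order, and let $\tilde L_1,\tilde L_2,\dots$ be the cycle lengths when the cycles are ordered by their smallest element; both sequences are continued by zeros. Let $X_1,X_2,\dots$ be i.i.d. beta random variables with parameters $(1,\theta)$, that is, $\mathbb P(X_i>s)=(1-s)^\theta$ for $0\le s\le1$. The law of the sequence $(X_1,(1-X_1)X_2,(1-X_1)(1-X_2)X_3,\dots)$ is the Griffiths–Engen–McCloskey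 distribution $\mathrm{GEM}(\theta)$, and the law of its nonincreasing rearrangement is the Poisson–Dirichlet distribution $\mathrm{PD}(\theta)$. Then $h_n>0$ for all sufficiently large $n$ (so that $\mathbb P_n$ is a probability distribution for these $n$), and, as $n\to\infty$, under $\mathbb P_n$: (a) the sequence $(R_1,R_2,R_3,\dots)$ converges weakly to a sequence of independent Poisson random variables with respective means $\theta_1,\frac{\theta_2}2,\frac{\theta_3}3,\dots$; (b) $\displaystyle\lim_{n\to\infty}\frac{\mathbb E_n(K)}{\log n}=\theta$; (c) the sequence $\bigl(\frac{\tilde L_1}n,\frac{\tilde L_2}n,\dots\bigr)$ converges weakly to $\mathrm{GEM}(\theta)$, and the sequence $\bigl(\frac{L^{(1)}}n,\frac{L^{(2)}}n,\dots\bigr)$ converges weakly to $\mathrm{PD}(\theta)$. Weak convergence of random sequences refers to the product topology on $\mathbb N^{\mathbb N}$ (with $\mathbb N=\{0,1,2,\dots\}$ discrete) and on $\mathbb R^{\mathbb N}$, respectively. -/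

import Mathlib

open Filter Topology MeasureTheory ProbabilityTheory
open scoped NNReal ENNReal

namespace WeightedPerm

/-- Every set of permutations is an event. -/
instance instMeasurableSpacePerm (n : ℕ) : MeasurableSpace (Equiv.Perm (Fin n)) := ⊤

/-- `R_j(σ)`: the number of cycles of length `j` of `σ` (fixed points are cycles of length one;
`σ.partition.parts` is the multiset of all cycle lengths). -/
def R {n : ℕ} (j : ℕ) (σ : Equiv.Perm (Fin n)) : ℕ :=
  σ.partition.parts.count j

/-- `K(σ)`: the total number of cycles. -/
def K {n : ℕ} (σ : Equiv.Perm (Fin n)) : ℕ :=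
  ∑ j ∈ Finset.Icc 1 n, R j σ

/-- The weight `∏_{j ≥ 1} θ_j ^ R_j(σ)`; factors with `j > n` are equal to one, and `θ 0` is never
used. -/
noncomputable def weight (θ : ℕ → ℝ≥0) {n : ℕ} (σ : Equiv.Perm (Fin n)) : ℝ≥0 :=
  ∏ j ∈ Finset.Icc 1 n, θ j ^ R j σ

/-- The normalization `h_n = (1 / n!) ∑_σ ∏_j θ_j ^ R_j(σ)`. -/
noncomputable def h (θ : ℕ → ℝ≥0) (n : ℕ) : ℝ≥0 :=
  (1 / (n.factorial : ℝ≥0)) * ∑ σ : Equiv.Perm (Fin n), weight θ σ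

/-- The probability `P_n(σ)` of a single permutation. -/
noncomputable def prob (θ : ℕ → ℝ≥0) {n : ℕ} (σ : Equiv.Perm (Fin n)) : ℝ≥0 :=
  1 / ((n.factorial : ℝ≥0) * h θ n) * weight θ σ

/-- `P_n` as a measure on the permutations of `n` elements. It is a probability measure if
`h_n > 0`, and the zero measure otherwise, which is why it is a `FiniteMeasure`. -/
noncomputable def P (θ : ℕ → ℝ≥0) (n : ℕ) : FiniteMeasure (Equiv.Perm (Fin n)) :=
  ∑ σ : Equiv.Perm (Fin n), prob θ σ • (diracProba σ).toFiniteMeasure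

/-- The finite cycle counts `(R_1, R_2, R_3, …)`. -/
def cycleCounts {n : ℕ} (σ : Equiv.Perm (Fin n)) : ℕ → ℕ :=
  fun i => R (i + 1) σ

/-- The cycle lengths in nonincreasing order, divided by `n` and continued by zeros:
`(L⁽¹⁾ / n, L⁽²⁾ / n, …)`. -/
noncomputable def rankedLengths {n : ℕ} (σ : Equiv.Perm (Fin n)) : ℕ → ℝ :=
  fun i => (((σ.partition.parts.sort (· ≥ ·)).getD i 0 : ℕ) : ℝ) / n

open Classical in
/-- The smallest elements of the cycles of `σ`, in increasing order. -/
noncomputable def leaders {n : ℕ} (σ : Equiv.Perm (Fin n)) : List (Fin n) :=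
  (List.finRange n).filter fun a => ∀ b, σ.SameCycle a b → a ≤ b

/-- The cycle lengths, where the cycles are ordered by their smallest element, divided by `n` and
continued by zeros. -/
noncomputable def ageOrderedLengths {n : ℕ} (σ : Equiv.Perm (Fin n)) : ℕ → ℝ :=
  fun i => ((((leaders σ).map fun a => Set.ncard {b | σ.SameCycle a b}).getD i 0 : ℕ) : ℝ) / n

/-- The law of independent Poisson variables with means `θ_1, θ_2 / 2, θ_3 / 3, …`. -/
noncomputable def poissonLaw (θ : ℕ → ℝ≥0) : ProbabilityMeasure (ℕ → ℕ) :=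
  ⟨Measure.infinitePi fun i : ℕ => poissonMeasure (θ (i + 1) / (i + 1)), inferInstance⟩

/-- The sequence `(x_1, (1 - x_1) x_2, (1 - x_1) (1 - x_2) x_3, …)`. -/
noncomputable def stickBreaking (x : ℕ → ℝ) : ℕ → ℝ :=
  fun i => (∏ j ∈ Finset.range i, (1 - x j)) * x i

theorem measurable_stickBreaking : Measurable stickBreaking := by
  unfold stickBreaking
  fun_prop

/-- The nonincreasing rearrangement of a sequence of nonnegative numbers that tends to zero: the
entry with index `k` is the `(k + 1)`-st largest number of the sequence (with multiplicity), which
is the largest possible minimum over `k + 1` distinct indices. -/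
noncomputable def ranked (u : ℕ → ℝ) : ℕ → ℝ :=
  fun k => ⨆ S : {S : Finset ℕ // S.card = k + 1},
    S.1.inf' (Finset.card_pos.mp (by rw [S.2]; exact k.succ_pos)) u

theorem measurable_ranked : Measurable ranked := by
  refine measurable_pi_lambda _ fun k => Measurable.iSup fun S => ?_
  have hS : S.1.Nonempty := Finset.card_pos.mp (by rw [S.2]; exact k.succ_pos)
  have hm : Measurable (S.1.inf' hS fun i (u : ℕ → ℝ) => u i) :=
    Finset.inf'_induction hS _ (fun _ hf _ hg => hf.inf hg) fun i _ => measurable_pi_apply i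
  have he : (fun u : ℕ → ℝ => S.1.inf' hS u) = S.1.inf' hS fun i (u : ℕ → ℝ) => u i := by
    ext u
    rw [Finset.inf'_apply]
  rw [← he] at hm
  exact hm

/-- The law of a sequence of independent beta variables with parameters `(1, θ)`. -/
noncomputable def iidBeta (θ : ℝ) (hθ : 0 < θ) : ProbabilityMeasure (ℕ → ℝ) :=
  haveI := isProbabilityMeasureBeta one_pos hθ
  ⟨Measure.infinitePi fun _ : ℕ => betaMeasure 1 θ, inferInstance⟩

/-- The Griffiths–Engen–McCloskey distribution. -/
noncomputable def gem (θ : ℝ) (hθ : 0 < θ) : ProbabilityMeasure (ℕ → ℝ) :=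
  (iidBeta θ hθ).map measurable_stickBreaking.aemeasurable

/-- The Poisson–Dirichlet distribution. -/
noncomputable def poissonDirichlet (θ : ℝ) (hθ : 0 < θ) : ProbabilityMeasure (ℕ → ℝ) :=
  (gem θ hθ).map measurable_ranked.aemeasurable

end WeightedPerm

/-!
Everything about the weighted permutations is derived from one recursion. Removing the element `0`
from a permutation of `n + 1` elements (`Equiv.Perm.decomposeFin`) shows how the list of cycle
lengths, ordered by smallest elements, changes; averaged over all permutations this says that the
first cycle has a uniformly distributed length and that the rest is a uniform permutation of the
remaining elements (`uniformMean_recursions`). With weights, and with `U n F` the weighted average of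
a function `F` of the list of cycle lengths, it becomes
`(n + 1) * U (n + 1) F = ∑ θ (i + 1) * U k (F ((i + 1) :: ·))`, the sum being over `i + k = n`
(`weightedMean_succ`). The case `F = 1` is a recursion for the normalizations `h n`.

*Asymptotics.* With `H n = ∑_{k < n} h k`, the recursion gives `n h n ≤ C H n`. Hence the last few
`h k` are negligible compared with `H n`, the weights may be replaced by their limit `ϑ`, and
`n h n / H n → ϑ` (`tendsto_mul_mass_div_cumMass`). This is all the regularity that is needed: it
implies `h n > 0` for large `n`, `h (n + 1) / h n → 1`, and, by the Stolz–Cesàro theorem, the limits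
of sums such as `∑_{m < n} m ^ B h m / (n ^ B H n)`.

*Cycle counts.* Marking a cycle of length `k` amounts to removing it (`weightedMean_count_mul`). So
the joint law of the numbers of cycles with lengths in a finite set `s` is a product of Poisson
weights times the mass of the permutations without such cycles, and forbidding the length `k` costs
asymptotically the factor `exp (-θ k / k)` (`tendsto_mass_div_mass_update`). Cylinder sets form a
π-system that determines weak convergence. The mean number of cycles is
`∑_j θ j / j * h (n - j) / h n`, which is compared with `∑_j θ j / j`.

*GEM.* The residuals `y i`, the fractions left after the first `i` pieces, determine the sequence, and
on the compact cube convergence of the integrals of all monomials in them suffices, by the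
Stone–Weierstrass theorem (`tendsto_of_tendsto_integral_prod`). Splitting off the first cycle turns
the moments of the residuals into a product of factors `ϑ / (ϑ + B)`, which are the moments
`E (1 - X) ^ B` of the beta distribution (`ConvergentWeights.tendsto_restProd`,
`integral_residual_gem`).

*Poisson–Dirichlet.* The nonincreasing rearrangement is not continuous in the product topology, but it
is uniformly close, up to the residual `y N`, to the rearrangement of the first `N` entries, which is
continuous; and `E (y N)` tends to `(ϑ / (ϑ + 1)) ^ N`, which is small for large `N`.
-/

namespace WeightedPerm

open Finset.HasAntidiagonal (antidiagonal mem_antidiagonal)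

/-! ### Removing the smallest element of a permutation -/

open Equiv.Perm in
/-- A map that sends each step of `σ` into a cycle of `τ` sends cycles into cycles. -/
theorem sameCycle_map {α β : Type*} [Finite α] {σ : Equiv.Perm α} {τ : Equiv.Perm β} (f : α → β)
    (hf : ∀ x, τ.SameCycle (f x) (f (σ x))) {x y : α} (hxy : σ.SameCycle x y) :
    τ.SameCycle (f x) (f y) := by
  obtain ⟨k, rfl⟩ := hxy.exists_nat_pow_eq
  clear hxy
  induction k with
  | zero => exact SameCycle.refl _ _
  | succ k ih =>
    rw [pow_succ', mul_apply]
    exact ih.trans (hf _)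

section decomposeFin

variable {n : ℕ} (e : Equiv.Perm (Fin n))

/-- Inserting `0` in front of `q` merges it into the cycle of `q` and leaves the cycles otherwise
unchanged. -/
theorem sameCycle_insert_iff (q : Fin n) (x y : Fin (n + 1)) :
    (Equiv.Perm.decomposeFin.symm (q.succ, e)).SameCycle x y ↔
      e.SameCycle (Fin.cases q id x) (Fin.cases q id y) := by
  set σ := Equiv.Perm.decomposeFin.symm (q.succ, e) with hσ
  have h0 : σ 0 = q.succ := by simp [hσ]
  have h1 : ∀ a, e a ≠ q → σ a.succ = (e a).succ := by
    intro a ha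
    rw [hσ, Equiv.Perm.decomposeFin_symm_apply_succ]
    exact Equiv.swap_apply_of_ne_of_ne (Fin.succ_ne_zero _) (fun h => ha (Fin.succ_injective _ h))
  have h2 : ∀ a, e a = q → σ a.succ = 0 := by
    intro a ha
    rw [hσ, Equiv.Perm.decomposeFin_symm_apply_succ, ha, Equiv.swap_apply_right]
  constructor
  · refine sameCycle_map (τ := e) (fun x => (Fin.cases q id x : Fin n)) fun x => ?_
    refine Fin.cases ?_ (fun a => ?_) x
    · simp only [h0]
      exact Equiv.Perm.SameCycle.refl _ _
    · by_cases ha : e a = q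
      · simp only [h2 a ha, Fin.cases_zero, Fin.cases_succ, id]
        rw [← ha]
        exact (Equiv.Perm.sameCycle_apply_right).2 (Equiv.Perm.SameCycle.refl _ _)
      · simp only [h1 a ha, Fin.cases_succ, id]
        exact (Equiv.Perm.sameCycle_apply_right).2 (Equiv.Perm.SameCycle.refl _ _)
  · intro h
    have hproj : ∀ z : Fin (n + 1), σ.SameCycle z (Fin.cases q id z : Fin n).succ := by
      intro z
      refine Fin.cases ?_ (fun a => ?_) z
      · simp only [Fin.cases_zero, ← h0]
        exact (Equiv.Perm.sameCycle_apply_right).2 (Equiv.Perm.SameCycle.refl _ _)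
      · exact Equiv.Perm.SameCycle.refl _ _
    refine (hproj x).trans (.trans ?_ (hproj y).symm)
    refine sameCycle_map (τ := σ) Fin.succ (fun a => ?_) h
    by_cases ha : e a = q
    · have : (e a).succ = σ (σ a.succ) := by rw [h2 a ha, h0, ha]
      rw [this]
      simp only [Equiv.Perm.sameCycle_apply_right]
      exact Equiv.Perm.SameCycle.refl _ _
    · rw [← h1 a ha]
      exact (Equiv.Perm.sameCycle_apply_right).2 (Equiv.Perm.SameCycle.refl _ _)

theorem sameCycle_extend_zero (y : Fin (n + 1)) :
    (Equiv.Perm.decomposeFin.symm (0, e)).SameCycle 0 y ↔ y = 0 := by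
  constructor
  · intro h
    exact (h.eq_of_left (by simp [Function.IsFixedPt])).symm
  · rintro rfl
    exact Equiv.Perm.SameCycle.refl _ _

theorem sameCycle_extend_succ (a b : Fin n) :
    (Equiv.Perm.decomposeFin.symm (0, e)).SameCycle a.succ b.succ ↔ e.SameCycle a b := by
  set σ := Equiv.Perm.decomposeFin.symm (0, e) with hσ
  have h1 : ∀ a : Fin n, σ a.succ = (e a).succ := by intro a; simp [hσ]
  constructor
  · intro h
    have := sameCycle_map (τ := e) (σ := σ) (fun x => Fin.cases a id x) (fun x => ?_) h
    · simpa using this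
    · refine Fin.cases ?_ (fun b => ?_) x
      · simp [hσ, Equiv.Perm.SameCycle.refl]
      · simp only [h1, Fin.cases_succ, id]
        exact (Equiv.Perm.sameCycle_apply_right).2 (Equiv.Perm.SameCycle.refl _ _)
  · refine sameCycle_map (τ := σ) Fin.succ fun a => ?_
    rw [← h1]
    exact (Equiv.Perm.sameCycle_apply_right).2 (Equiv.Perm.SameCycle.refl _ _)

end decomposeFin

/-- The length of the cycle of `σ` through `a`. -/
noncomputable def cycleSize {n : ℕ} (σ : Equiv.Perm (Fin n)) (a : Fin n) : ℕ :=
  Set.ncard {b | σ.SameCycle a b}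

/-- The cycle lengths of `σ`, where the cycles are ordered by their smallest element. -/
noncomputable def ageLengths {n : ℕ} (σ : Equiv.Perm (Fin n)) : List ℕ :=
  (leaders σ).map (cycleSize σ)

theorem mem_leaders {n : ℕ} {σ : Equiv.Perm (Fin n)} {a : Fin n} :
    a ∈ leaders σ ↔ ∀ b, σ.SameCycle a b → a ≤ b := by
  simp [leaders]

theorem nodup_leaders {n : ℕ} (σ : Equiv.Perm (Fin n)) : (leaders σ).Nodup :=
  (List.nodup_finRange n).filter _

theorem leaders_eq_of_sameCycle {n : ℕ} {σ : Equiv.Perm (Fin n)} {a b : Fin n}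
    (ha : a ∈ leaders σ) (hb : b ∈ leaders σ) (h : σ.SameCycle a b) : a = b :=
  le_antisymm (mem_leaders.1 ha _ h) (mem_leaders.1 hb _ h.symm)

theorem exists_leader {n : ℕ} (σ : Equiv.Perm (Fin n)) (p : Fin n) :
    ∃ a ∈ leaders σ, σ.SameCycle a p := by
  classical
  have hne : (Finset.univ.filter fun b => σ.SameCycle p b).Nonempty :=
    ⟨p, by simp [Equiv.Perm.SameCycle.refl]⟩
  have hm := Finset.min'_mem _ hne
  simp only [Finset.mem_filter, Finset.mem_univ, true_and] at hm
  exact ⟨_, mem_leaders.2 fun b hb => Finset.min'_le _ _ (by simpa using hm.trans hb), hm.symm⟩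

theorem cycleSize_eq_card {n : ℕ} (σ : Equiv.Perm (Fin n)) (a : Fin n) [DecidableRel σ.SameCycle] :
    cycleSize σ a = (Finset.univ.filter fun b => σ.SameCycle a b).card := by
  rw [cycleSize, ← Set.ncard_coe_finset]
  simp

theorem ageLengths_extend {n : ℕ} (e : Equiv.Perm (Fin n)) :
    ageLengths (Equiv.Perm.decomposeFin.symm (0, e)) = 1 :: ageLengths e := by
  classical
  set σ := Equiv.Perm.decomposeFin.symm (0, e) with hσ
  have hl : leaders σ = 0 :: (leaders e).map Fin.succ := by
    unfold leaders
    rw [List.finRange_succ, List.filter_cons_of_pos (by simp), List.filter_map]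
    congr 2
    refine List.filter_congr fun a _ => ?_
    simp only [Function.comp, decide_eq_decide]
    constructor
    · intro h b hb
      have := h b.succ ((sameCycle_extend_succ e a b).2 hb)
      exact Fin.succ_le_succ_iff.1 this
    · intro h b hb
      refine Fin.cases (fun hb => ?_) (fun b hb => ?_) b hb
      · exact absurd ((sameCycle_extend_zero e _).1 hb.symm) (Fin.succ_ne_zero _)
      · exact Fin.succ_le_succ_iff.2 (h b ((sameCycle_extend_succ e a b).1 hb))
  unfold ageLengths
  rw [hl, List.map_cons, List.map_map]
  congr 1
  · have : {b | σ.SameCycle 0 b} = {0} := by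
      ext b; exact sameCycle_extend_zero e b
    rw [cycleSize, this, Set.ncard_singleton]
  · refine List.map_congr_left fun a _ => ?_
    have : {b | σ.SameCycle a.succ b} = Fin.succ '' {b | e.SameCycle a b} := by
      ext b
      refine Fin.cases ?_ (fun b => ?_) b
      · simp only [Set.mem_ofPred_eq, Set.mem_image, Fin.succ_ne_zero, and_false, exists_false,
          iff_false]
        intro hb
        exact absurd ((sameCycle_extend_zero e _).1 hb.symm) (Fin.succ_ne_zero _)
      · simp [hσ, sameCycle_extend_succ]
    simp only [Function.comp, cycleSize]
    rw [this, Set.ncard_image_of_injective _ (Fin.succ_injective _)]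

open Classical in
/-- Inserting `0` into the cycle with smallest element `p` makes this cycle the first one. -/
theorem ageLengths_insert {n : ℕ} (e : Equiv.Perm (Fin n)) (q : Fin n) {p : Fin n}
    (hp : p ∈ leaders e) (hpq : e.SameCycle p q) :
    ageLengths (Equiv.Perm.decomposeFin.symm (q.succ, e)) =
      (cycleSize e p + 1) :: ((leaders e).filter (· ≠ p)).map (cycleSize e) := by
  set σ := Equiv.Perm.decomposeFin.symm (q.succ, e) with hσ
  have hsc := sameCycle_insert_iff e q
  rw [← hσ] at hsc
  have hl : leaders σ = 0 :: ((leaders e).filter (· ≠ p)).map Fin.succ := by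
    unfold leaders
    rw [List.finRange_succ, List.filter_cons_of_pos (by simp), List.filter_map, List.filter_filter]
    congr 2
    refine List.filter_congr fun a _ => ?_
    simp only [Function.comp, ← Bool.decide_and, decide_eq_decide]
    constructor
    · intro h
      have h2 : ∀ b, e.SameCycle a b → a ≤ b := fun b hb =>
        Fin.succ_le_succ_iff.1 (h b.succ ((hsc _ _).2 hb))
      refine ⟨?_, h2⟩
      rintro rfl
      have := h 0 ((hsc _ _).2 hpq)
      simp at this
    · rintro ⟨hne, h⟩ b hb
      refine Fin.cases (fun hb => ?_) (fun b hb => ?_) b hb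
      · exact absurd (leaders_eq_of_sameCycle (mem_leaders.2 h) hp
          (((hsc _ _).1 hb).trans hpq.symm)) hne
      · exact Fin.succ_le_succ_iff.2 (h b ((hsc _ _).1 hb))
  unfold ageLengths
  rw [hl, List.map_cons, List.map_map]
  congr 1
  · have : {b | σ.SameCycle 0 b} = insert 0 (Fin.succ '' {b | e.SameCycle p b}) := by
      ext b
      refine Fin.cases ?_ (fun b => ?_) b
      · simp [Equiv.Perm.SameCycle.refl]
      · simp only [Set.mem_ofPred_eq, Set.mem_insert_iff, Fin.succ_ne_zero, false_or,
          Set.mem_image, Fin.succ_inj, exists_eq_right]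
        exact (hsc _ _).trans ⟨fun h => hpq.trans h, fun h => hpq.symm.trans h⟩
    rw [cycleSize, this, Set.ncard_insert_of_notMem (by simp [Fin.succ_ne_zero]),
      Set.ncard_image_of_injective _ (Fin.succ_injective _), cycleSize]
  · refine List.map_congr_left fun a ha => ?_
    simp only [ne_eq, List.mem_filter, decide_not, Bool.not_eq_eq_eq_not, Bool.not_true,
      decide_eq_false_iff_not] at ha
    have : {b | σ.SameCycle a.succ b} = Fin.succ '' {b | e.SameCycle a b} := by
      ext b
      refine Fin.cases ?_ (fun b => ?_) b
      · simp only [Set.mem_ofPred_eq, Set.mem_image, Fin.succ_ne_zero, and_false, exists_false,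
          iff_false]
        intro hb
        exact ha.2 (leaders_eq_of_sameCycle ha.1 hp (((hsc _ _).1 hb).trans hpq.symm))
      · simp only [Set.mem_ofPred_eq, Set.mem_image, Fin.succ_inj, exists_eq_right]
        exact hsc _ _
    simp only [Function.comp, cycleSize]
    rw [this, Set.ncard_image_of_injective _ (Fin.succ_injective _)]

/-! ### The recursion for uniform permutations -/

/-- The sum of `c * H c l'` over all ways of taking one entry `c` out of the list `l`, where `l'` is
the rest of the list. -/
def sumTakeOut : (ℕ → List ℕ → ℝ) → List ℕ → ℝ
  | _, [] => 0
  | H, c :: l => c * H c l + sumTakeOut (fun k l' => H k (c :: l')) l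

theorem sum_map_filter_ne {α : Type*} [DecidableEq α] (c : α → ℕ) {L : List α} (hL : L.Nodup)
    (H : ℕ → List ℕ → ℝ) :
    (L.map fun a => (c a : ℝ) * H (c a) ((L.filter (· ≠ a)).map c)).sum =
      sumTakeOut H (L.map c) := by
  induction L generalizing H with
  | nil => rfl
  | cons a L ih =>
    rw [List.nodup_cons] at hL
    rw [List.map_cons, List.map_cons, List.sum_cons, sumTakeOut, ← ih hL.2]
    congr 2
    · congr 2
      rw [List.filter_cons_of_neg (by simp), List.filter_eq_self.2]
      intro b hb
      have : b ≠ a := fun h => hL.1 (h ▸ hb)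
      simpa using this
    · refine List.map_congr_left fun b hb => ?_
      rw [List.filter_cons_of_pos (by simpa using fun h : a = b => hL.1 (h ▸ hb)), List.map_cons]

theorem sum_ageLengths_insert {n : ℕ} (e : Equiv.Perm (Fin n)) (F : List ℕ → ℝ) :
    ∑ q : Fin n, F (ageLengths (Equiv.Perm.decomposeFin.symm (q.succ, e))) =
      sumTakeOut (fun k l => F ((k + 1) :: l)) (ageLengths e) := by
  classical
  rw [ageLengths, ← sum_map_filter_ne _ (nodup_leaders e), ← List.sum_toFinset _ (nodup_leaders e)]
  have : ∀ q : Fin n, F (ageLengths (Equiv.Perm.decomposeFin.symm (q.succ, e))) =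
      ∑ p ∈ (leaders e).toFinset, if e.SameCycle p q then
        F ((cycleSize e p + 1) :: ((leaders e).filter (· ≠ p)).map (cycleSize e)) else 0 := by
    intro q
    obtain ⟨p, hp, hpq⟩ := exists_leader e q
    rw [Finset.sum_eq_single_of_mem p (by simpa using hp), if_pos hpq, ageLengths_insert e q hp hpq]
    intro p' hp' hne
    rw [if_neg]
    exact fun h => hne (leaders_eq_of_sameCycle (by simpa using hp') hp (h.trans hpq.symm))
  simp_rw [this]
  rw [Finset.sum_comm]
  refine Finset.sum_congr rfl fun p _ => ?_
  rw [← Finset.sum_filter, Finset.sum_const, ← cycleSize_eq_card, nsmul_eq_mul]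

/-- The average of a function of the age-ordered cycle lengths over all permutations of `n`
elements. -/
noncomputable def uniformMean (n : ℕ) (F : List ℕ → ℝ) : ℝ :=
  (1 / (n.factorial : ℝ)) * ∑ σ : Equiv.Perm (Fin n), F (ageLengths σ)

theorem uniformMean_zero (F : List ℕ → ℝ) : uniformMean 0 F = F [] := by
  simp [uniformMean, ageLengths, leaders]

theorem uniformMean_add (n : ℕ) (F G : List ℕ → ℝ) :
    uniformMean n (fun l => F l + G l) = uniformMean n F + uniformMean n G := by
  simp [uniformMean, Finset.sum_add_distrib, mul_add]

theorem uniformMean_const_mul (n : ℕ) (c : ℝ) (F : List ℕ → ℝ) :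
    uniformMean n (fun l => c * F l) = c * uniformMean n F := by
  simp only [uniformMean, ← Finset.mul_sum]
  ring

/-- The element `0` either is a fixed point or has been inserted into one of the cycles. -/
theorem uniformMean_succ_eq_add (n : ℕ) (F : List ℕ → ℝ) :
    (n + 1) * uniformMean (n + 1) F = uniformMean n (fun l => F (1 :: l)) +
      uniformMean n (sumTakeOut fun k l => F ((k + 1) :: l)) := by
  have hsum : ∑ σ : Equiv.Perm (Fin (n + 1)), F (ageLengths σ) =
      ∑ e : Equiv.Perm (Fin n), (F (1 :: ageLengths e) +
        sumTakeOut (fun k l => F ((k + 1) :: l)) (ageLengths e)) := by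
    rw [← Equiv.sum_comp Equiv.Perm.decomposeFin.symm, Fintype.sum_prod_type_right]
    refine Finset.sum_congr rfl fun e _ => ?_
    rw [Fin.sum_univ_succ, ageLengths_extend, sum_ageLengths_insert]
  rw [uniformMean, hsum, Nat.factorial_succ, ← uniformMean_add, uniformMean]
  have : (n.factorial : ℝ) ≠ 0 := by positivity
  push_cast
  field_simp

theorem sum_antidiagonal_exchange (n : ℕ) (f : ℕ → ℕ → ℕ → ℝ) :
    ∑ p ∈ antidiagonal n, ∑ q ∈ antidiagonal p.2, f p.1 q.1 q.2 =
      ∑ p ∈ antidiagonal n, ∑ q ∈ antidiagonal p.2, f q.1 p.1 q.2 := by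
  rw [Finset.sum_sigma', Finset.sum_sigma']
  refine Finset.sum_bij' (fun x _ => ⟨(x.2.1, x.1.1 + x.2.2), (x.1.1, x.2.2)⟩)
    (fun x _ => ⟨(x.2.1, x.1.1 + x.2.2), (x.1.1, x.2.2)⟩) ?_ ?_ ?_ ?_ ?_
  all_goals
    rintro ⟨⟨a, b⟩, ⟨c, d⟩⟩ h
    simp only [Finset.mem_sigma, mem_antidiagonal] at h ⊢
    try simp
    try omega

/-- Two descriptions of a uniform permutation, proved together by induction: the cycle of a uniformly
chosen element, and the cycle of the smallest element, have a uniformly distributed length, and the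
remaining cycles are those of a uniform permutation of the remaining elements. -/
theorem uniformMean_recursions (n : ℕ) :
    (∀ H : ℕ → List ℕ → ℝ, uniformMean (n + 1) (sumTakeOut H) =
      ∑ p ∈ antidiagonal n, uniformMean p.2 (H (p.1 + 1))) ∧
    ∀ F : List ℕ → ℝ, (n + 1) * uniformMean (n + 1) F =
      ∑ p ∈ antidiagonal n, uniformMean p.2 (fun l => F ((p.1 + 1) :: l)) := by
  induction n using Nat.strong_induction_on with
  | _ n ih =>
  have hmaster : ∀ F : List ℕ → ℝ, (n + 1) * uniformMean (n + 1) F =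
      ∑ p ∈ antidiagonal n, uniformMean p.2 (fun l => F ((p.1 + 1) :: l)) := by
    intro F
    rw [uniformMean_succ_eq_add]
    cases n with
    | zero => simp [uniformMean_zero, sumTakeOut]
    | succ m =>
      rw [(ih m (Nat.lt_succ_self m)).1, Finset.Nat.sum_antidiagonal_succ]
  refine ⟨fun H => ?_, hmaster⟩
  have hn : ((n : ℝ) + 1) ≠ 0 := by positivity
  refine mul_left_cancel₀ hn ?_
  rw [hmaster, Finset.mul_sum]
  have h1 : ∀ p ∈ antidiagonal n,
      uniformMean p.2 (fun l => sumTakeOut H ((p.1 + 1) :: l)) =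
        ((p.1 : ℝ) + 1) * uniformMean p.2 (H (p.1 + 1)) +
          uniformMean p.2 (sumTakeOut fun k l' => H k ((p.1 + 1) :: l')) := by
    intro p _
    simp only [sumTakeOut]
    rw [uniformMean_add, uniformMean_const_mul]
    push_cast
    rfl
  have h2 : ∀ p ∈ antidiagonal n, ((n : ℝ) + 1) * uniformMean p.2 (H (p.1 + 1)) =
      ((p.1 : ℝ) + 1) * uniformMean p.2 (H (p.1 + 1)) + p.2 * uniformMean p.2 (H (p.1 + 1)) := by
    intro p hp
    have : (n : ℝ) = p.1 + p.2 := by exact_mod_cast (mem_antidiagonal.1 hp).symm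
    rw [this]; ring
  rw [Finset.sum_congr rfl h1, Finset.sum_congr rfl h2, Finset.sum_add_distrib,
    Finset.sum_add_distrib]
  congr 1
  cases n with
  | zero => simp [uniformMean_zero, sumTakeOut]
  | succ m =>
    rw [Finset.Nat.sum_antidiagonal_succ', Finset.Nat.sum_antidiagonal_succ']
    simp only [uniformMean_zero, sumTakeOut, Nat.cast_zero, zero_mul, zero_add]
    have h3 : ∀ p ∈ antidiagonal m,
        uniformMean (p.2 + 1) (sumTakeOut fun k l' => H k ((p.1 + 1) :: l')) =
          ∑ q ∈ antidiagonal p.2,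
            uniformMean q.2 (fun l' => H (q.1 + 1) ((p.1 + 1) :: l')) := by
      intro p hp
      rw [(ih p.2 (by have := mem_antidiagonal.1 hp; omega)).1]
    have h4 : ∀ p ∈ antidiagonal m,
        ((p.2 + 1 : ℕ) : ℝ) * uniformMean (p.2 + 1) (H (p.1 + 1)) =
          ∑ q ∈ antidiagonal p.2,
            uniformMean q.2 (fun l' => H (p.1 + 1) ((q.1 + 1) :: l')) := by
      intro p hp
      rw [← (ih p.2 (by have := mem_antidiagonal.1 hp; omega)).2]
      push_cast
      rfl
    rw [Finset.sum_congr rfl h3, Finset.sum_congr rfl h4]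
    exact sum_antidiagonal_exchange m fun a b c =>
      uniformMean c (fun l' => H (b + 1) ((a + 1) :: l'))

/-! ### Age-ordered cycle lengths and the cycle type -/

theorem cycleSize_of_apply_eq {n : ℕ} {σ : Equiv.Perm (Fin n)} {a : Fin n} (h : σ a = a) :
    cycleSize σ a = 1 := by
  have : {b | σ.SameCycle a b} = {a} := by
    ext b
    constructor
    · intro hb
      exact (hb.eq_of_left h).symm
    · rintro rfl
      exact Equiv.Perm.SameCycle.refl _ _
  rw [cycleSize, this, Set.ncard_singleton]

theorem cycleSize_of_apply_ne {n : ℕ} {σ : Equiv.Perm (Fin n)} {a : Fin n} (h : σ a ≠ a) :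
    cycleSize σ a = (σ.cycleOf a).support.card := by
  rw [cycleSize_eq_card]
  congr 1
  ext b
  simp [Equiv.Perm.mem_support_cycleOf_iff' h]

/-- As a multiset, the age-ordered cycle lengths are the cycle type completed by the fixed points. -/
theorem coe_ageLengths {n : ℕ} (σ : Equiv.Perm (Fin n)) :
    (ageLengths σ : Multiset ℕ) = σ.partition.parts := by
  classical
  set A : Finset (Fin n) := (leaders σ).toFinset with hA
  have hAval : (leaders σ : Multiset (Fin n)) = A.val := by
    rw [hA, List.toFinset_val, List.dedup_eq_self.2 (nodup_leaders σ)]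
  have hmem : ∀ a, a ∈ A ↔ a ∈ leaders σ := fun a => by simp [hA]
  rw [ageLengths, ← Multiset.map_coe, hAval, ← Multiset.filter_add_not (fun a => σ a ≠ a) A.val,
    Multiset.map_add, Equiv.Perm.parts_partition]
  congr 1
  · rw [Equiv.Perm.cycleType_def]
    -- The nontrivial cycles correspond to their smallest elements.
    have himage : σ.cycleFactorsFinset = (A.filter fun a => σ a ≠ a).image σ.cycleOf := by
      ext c
      rw [Finset.mem_image]
      constructor
      · intro hc
        obtain ⟨x, hx⟩ := (Equiv.Perm.mem_cycleFactorsFinset_iff.1 hc).1.nonempty_support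
        obtain ⟨a, ha, hax⟩ := exists_leader σ x
        have hcx := Equiv.Perm.cycle_is_cycleOf hx hc
        have hσx : σ x ≠ x := Equiv.Perm.mem_support.1
          (Equiv.Perm.mem_cycleFactorsFinset_support_le hc hx)
        refine ⟨a, Finset.mem_filter.2 ⟨(hmem a).2 ha, ?_⟩, ?_⟩
        · exact fun h => hσx (hax.apply_eq_self_iff.1 h)
        · rw [hcx, hax.cycleOf_eq]
      · rintro ⟨a, ha, rfl⟩
        rw [Equiv.Perm.cycleOf_mem_cycleFactorsFinset_iff, Equiv.Perm.mem_support]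
        exact (Finset.mem_filter.1 ha).2
    have hinj : Set.InjOn σ.cycleOf (A.filter fun a => σ a ≠ a : Finset (Fin n)) := by
      intro a ha b hb hab
      simp only [Finset.coe_filter, hmem, Set.mem_ofPred_eq] at ha hb
      refine leaders_eq_of_sameCycle ha.1 hb.1 ?_
      have hb' : b ∈ (σ.cycleOf b).support :=
        (Equiv.Perm.mem_support_cycleOf_iff' hb.2).2 (Equiv.Perm.SameCycle.refl _ _)
      rw [← hab] at hb'
      exact (Equiv.Perm.mem_support_cycleOf_iff' ha.2).1 hb'
    rw [himage, Finset.image_val_of_injOn hinj, Multiset.map_map, Finset.filter_val]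
    refine Multiset.map_congr rfl fun a ha => ?_
    exact cycleSize_of_apply_ne (Multiset.mem_filter.1 ha).2
  · rw [Multiset.eq_replicate]
    constructor
    · rw [Multiset.card_map, ← Finset.filter_val, Finset.card_val, ← Finset.card_compl]
      congr 1
      ext a
      simp only [Finset.mem_filter, hmem, not_not, Finset.mem_compl, Equiv.Perm.mem_support,
        and_iff_right_iff_imp]
      intro h
      exact mem_leaders.2 fun b hb => (hb.eq_of_left h).le
    · intro b hb
      obtain ⟨a, ha, rfl⟩ := Multiset.mem_map.1 hb
      exact cycleSize_of_apply_eq (not_not.1 (Multiset.mem_filter.1 ha).2)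

theorem sum_ageLengths {n : ℕ} (σ : Equiv.Perm (Fin n)) : (ageLengths σ).sum = n := by
  rw [← Multiset.sum_coe, coe_ageLengths, σ.partition.parts_sum, Fintype.card_fin]

theorem pos_of_mem_ageLengths {n : ℕ} {σ : Equiv.Perm (Fin n)} {c : ℕ} (h : c ∈ ageLengths σ) :
    0 < c := by
  rw [← Multiset.mem_coe, coe_ageLengths] at h
  exact σ.partition.parts_pos h

theorem le_of_mem_ageLengths {n : ℕ} {σ : Equiv.Perm (Fin n)} {c : ℕ} (h : c ∈ ageLengths σ) :
    c ≤ n :=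
  (List.single_le_sum (fun _ _ => Nat.zero_le _) c h).trans_eq (sum_ageLengths σ)

theorem R_eq_count {n : ℕ} (j : ℕ) (σ : Equiv.Perm (Fin n)) : R j σ = (ageLengths σ).count j := by
  rw [R, ← coe_ageLengths, Multiset.coe_count]

theorem weight_eq_prod {n : ℕ} (θ : ℕ → ℝ≥0) (σ : Equiv.Perm (Fin n)) :
    weight θ σ = ((ageLengths σ).map θ).prod := by
  rw [weight, Finset.prod_list_map_count]
  simp_rw [R_eq_count]
  refine (Finset.prod_subset ?_ ?_).symm
  · intro c hc
    rw [List.mem_toFinset] at hc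
    exact Finset.mem_Icc.2 ⟨pos_of_mem_ageLengths hc, le_of_mem_ageLengths hc⟩
  · intro c _ hc
    rw [List.mem_toFinset] at hc
    rw [List.count_eq_zero_of_not_mem hc, pow_zero]

/-! ### Nonincreasing rearrangement -/

theorem ranked_comp_equiv (u : ℕ → ℝ) (e : ℕ ≃ ℕ) : ranked (u ∘ e) = ranked u := by
  ext k
  let E : {S : Finset ℕ // S.card = k + 1} ≃ {S : Finset ℕ // S.card = k + 1} :=
    (Equiv.finsetCongr e).subtypeEquiv fun S => by simp
  unfold ranked
  refine Equiv.iSup_congr E fun S => ?_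
  simp [E, Finset.inf'_map]

/-- Among `k + 1` indices there is one that is at least `k`. -/
theorem ranked_of_antitone {u : ℕ → ℝ} (hu : Antitone u) : ranked u = u := by
  ext k
  have hle : ∀ S : {S : Finset ℕ // S.card = k + 1},
      S.1.inf' (Finset.card_pos.mp (by rw [S.2]; exact k.succ_pos)) u ≤ u k := by
    intro S
    obtain ⟨i, hi, hki⟩ : ∃ i ∈ S.1, k ≤ i := by
      by_contra! hcon
      have : S.1 ⊆ Finset.range k := fun i hi => Finset.mem_range.2 (hcon i hi)
      have := Finset.card_le_card this
      rw [S.2, Finset.card_range] at this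
      omega
    exact (Finset.inf'_le _ hi).trans (hu hki)
  have : Nonempty {S : Finset ℕ // S.card = k + 1} := ⟨⟨Finset.range (k + 1), by simp⟩⟩
  refine le_antisymm (ciSup_le hle) ?_
  refine le_ciSup_of_le ⟨u k, by rintro _ ⟨S, rfl⟩; exact hle S⟩
    ⟨Finset.range (k + 1), by simp⟩ ?_
  refine Finset.le_inf' _ _ fun i hi => hu ?_
  exact Nat.lt_succ_iff.1 (Finset.mem_range.1 hi)

theorem exists_equiv_getD_of_perm {α : Type*} (d : α) {l₁ l₂ : List α} (h : l₁.Perm l₂) :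
    ∃ e : ℕ ≃ ℕ, ∀ i, l₁.getD (e i) d = l₂.getD i d := by
  induction h with
  | nil => exact ⟨Equiv.refl _, fun _ => rfl⟩
  | @cons x l₁ l₂ _ ih =>
    obtain ⟨e, he⟩ := ih
    refine ⟨⟨fun i => Nat.casesOn i 0 fun i => e i + 1,
      fun i => Nat.casesOn i 0 fun i => e.symm i + 1, fun i => ?_, fun i => ?_⟩, fun i => ?_⟩
    · cases i <;> simp
    · cases i <;> simp
    · cases i with
      | zero => rfl
      | succ i => simpa using he i
  | swap x y l =>
    refine ⟨Equiv.swap 0 1, fun i => ?_⟩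
    match i with
    | 0 => simp
    | 1 => simp
    | i + 2 => rw [Equiv.swap_apply_of_ne_of_ne (by omega) (by omega)]; simp
  | trans _ _ ih₁ ih₂ =>
    obtain ⟨e₁, h₁⟩ := ih₁
    obtain ⟨e₂, h₂⟩ := ih₂
    exact ⟨e₂.trans e₁, fun i => by rw [Equiv.trans_apply, h₁, h₂]⟩

theorem ageOrderedLengths_eq {n : ℕ} (σ : Equiv.Perm (Fin n)) :
    ageOrderedLengths σ = fun i => (((ageLengths σ).getD i 0 : ℕ) : ℝ) / n := rfl

theorem antitone_getD_sort (s : Multiset ℕ) : Antitone fun i => (s.sort (· ≥ ·)).getD i 0 := by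
  intro i j hij
  have hs := s.pairwise_sort (· ≥ ·)
  simp only
  rcases lt_or_ge j (s.sort (· ≥ ·)).length with hj | hj
  · rw [List.getD_eq_getElem _ _ hj, List.getD_eq_getElem _ _ (hij.trans_lt hj)]
    rcases hij.eq_or_lt with rfl | hlt
    · exact le_rfl
    · exact List.pairwise_iff_getElem.1 hs i j _ hj hlt
  · rw [List.getD_eq_default _ _ hj]
    exact Nat.zero_le _

theorem rankedLengths_eq_ranked {n : ℕ} (σ : Equiv.Perm (Fin n)) :
    rankedLengths σ = ranked (ageOrderedLengths σ) := by
  have hperm : (ageLengths σ).Perm (σ.partition.parts.sort (· ≥ ·)) := by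
    rw [← Multiset.coe_eq_coe, coe_ageLengths, Multiset.sort_eq]
  obtain ⟨e, he⟩ := exists_equiv_getD_of_perm 0 hperm
  have h1 : rankedLengths σ = ageOrderedLengths σ ∘ e := by
    ext i
    simp only [rankedLengths, ageOrderedLengths_eq, Function.comp, he]
  have h2 : Antitone (rankedLengths σ) := by
    intro i j hij
    have := antitone_getD_sort σ.partition.parts hij
    simp only [rankedLengths]
    gcongr
  rw [← ranked_of_antitone h2, h1, ranked_comp_equiv]

/-! ### Weighted averages over permutations -/

/-- The average over all permutations of `n` elements of a function of the age-ordered cycle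
lengths, weighted with the product of the cycle weights. -/
noncomputable def weightedMean (θ : ℕ → ℝ) (n : ℕ) (F : List ℕ → ℝ) : ℝ :=
  uniformMean n fun l => (l.map θ).prod * F l

/-- The weighted average of the constant one: the normalization `h`, for real weights. -/
noncomputable def mass (θ : ℕ → ℝ) (n : ℕ) : ℝ :=
  weightedMean θ n fun _ => 1

theorem uniformMean_congr {n : ℕ} {F G : List ℕ → ℝ} (h : ∀ l : List ℕ, l.sum = n → F l = G l) :
    uniformMean n F = uniformMean n G := by
  unfold uniformMean
  congr 1
  exact Finset.sum_congr rfl fun σ _ => h _ (sum_ageLengths σ)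

theorem weightedMean_congr {θ : ℕ → ℝ} {n : ℕ} {F G : List ℕ → ℝ}
    (h : ∀ l : List ℕ, l.sum = n → F l = G l) : weightedMean θ n F = weightedMean θ n G :=
  uniformMean_congr fun l hl => by rw [h l hl]

theorem weightedMean_mono {θ : ℕ → ℝ} (hθ : ∀ j, 0 ≤ θ j) {n : ℕ} {F G : List ℕ → ℝ}
    (h : ∀ l : List ℕ, l.sum = n → F l ≤ G l) : weightedMean θ n F ≤ weightedMean θ n G := by
  unfold weightedMean uniformMean
  refine mul_le_mul_of_nonneg_left (Finset.sum_le_sum fun σ _ => ?_) (by positivity)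
  refine mul_le_mul_of_nonneg_left (h _ (sum_ageLengths σ)) (List.prod_nonneg fun x hx => ?_)
  obtain ⟨j, _, rfl⟩ := List.mem_map.1 hx
  exact hθ j

theorem weightedMean_zero (θ : ℕ → ℝ) (F : List ℕ → ℝ) : weightedMean θ 0 F = F [] := by
  simp [weightedMean, uniformMean_zero]

theorem weightedMean_add (θ : ℕ → ℝ) (n : ℕ) (F G : List ℕ → ℝ) :
    weightedMean θ n (fun l => F l + G l) = weightedMean θ n F + weightedMean θ n G := by
  simp only [weightedMean, mul_add]
  exact uniformMean_add n _ _

theorem weightedMean_const_mul (θ : ℕ → ℝ) (n : ℕ) (c : ℝ) (F : List ℕ → ℝ) :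
    weightedMean θ n (fun l => c * F l) = c * weightedMean θ n F := by
  simp only [weightedMean, mul_left_comm _ c]
  exact uniformMean_const_mul n c _

theorem weightedMean_const (θ : ℕ → ℝ) (n : ℕ) (c : ℝ) :
    weightedMean θ n (fun _ => c) = c * mass θ n := by
  rw [mass, ← weightedMean_const_mul]
  simp

theorem weightedMean_sum {ι : Type*} (θ : ℕ → ℝ) (n : ℕ) (s : Finset ι) (F : ι → List ℕ → ℝ) :
    weightedMean θ n (fun l => ∑ i ∈ s, F i l) = ∑ i ∈ s, weightedMean θ n (F i) := by
  classical
  induction s using Finset.induction_on with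
  | empty => simp [weightedMean_const]
  | insert i s hi ih => simp only [Finset.sum_insert hi, weightedMean_add, ih]

theorem weightedMean_nonneg {θ : ℕ → ℝ} (hθ : ∀ j, 0 ≤ θ j) {n : ℕ} {F : List ℕ → ℝ}
    (h : ∀ l : List ℕ, l.sum = n → 0 ≤ F l) : 0 ≤ weightedMean θ n F := by
  have := weightedMean_mono hθ (F := fun _ => 0) h
  simpa [weightedMean_const] using this

theorem weightedMean_succ (θ : ℕ → ℝ) (n : ℕ) (F : List ℕ → ℝ) :
    (n + 1) * weightedMean θ (n + 1) F = ∑ p ∈ antidiagonal n,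
      θ (p.1 + 1) * weightedMean θ p.2 (fun l => F ((p.1 + 1) :: l)) := by
  rw [weightedMean, (uniformMean_recursions n).2]
  refine Finset.sum_congr rfl fun p _ => ?_
  rw [weightedMean, ← uniformMean_const_mul]
  simp only [List.map_cons, List.prod_cons, mul_assoc]

theorem mass_nonneg {θ : ℕ → ℝ} (hθ : ∀ j, 0 ≤ θ j) (n : ℕ) : 0 ≤ mass θ n :=
  weightedMean_nonneg hθ fun _ _ => zero_le_one

theorem mass_zero (θ : ℕ → ℝ) : mass θ 0 = 1 := weightedMean_zero _ _

theorem mass_succ (θ : ℕ → ℝ) (n : ℕ) :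
    (n + 1) * mass θ (n + 1) = ∑ p ∈ antidiagonal n, θ (p.1 + 1) * mass θ p.2 :=
  weightedMean_succ θ n _

theorem sum_antidiagonal_add_eq (n k : ℕ) (f : ℕ × ℕ → ℝ) (hf : ∀ p, p.2 < k → f p = 0) :
    ∑ p ∈ antidiagonal (n + k), f p = ∑ p ∈ antidiagonal n, f (p.1, p.2 + k) := by
  induction k generalizing f with
  | zero => rfl
  | succ k ih =>
    rw [← add_assoc, Finset.Nat.sum_antidiagonal_succ', hf _ (Nat.succ_pos k), zero_add,
      ih _ fun p hp => hf _ (Nat.succ_lt_succ hp)]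
    simp only [add_assoc]

theorem weightedMean_count_of_lt (θ : ℕ → ℝ) {n k : ℕ} (h : n < k) (F : List ℕ → ℝ) :
    weightedMean θ n (fun l => (l.count k : ℝ) * F l) = 0 := by
  rw [weightedMean_congr (G := fun _ => 0), weightedMean_const, zero_mul]
  intro l hl
  rw [List.count_eq_zero_of_not_mem, Nat.cast_zero, zero_mul]
  intro hk
  have := List.single_le_sum (fun _ _ => Nat.zero_le _) k hk
  omega

/-- The Mecke-type identity: marking a cycle of length `k` amounts to removing it. -/
theorem weightedMean_count_mul (θ : ℕ → ℝ) {k : ℕ} (hk : 0 < k) (n : ℕ) (F : List ℕ → ℝ)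
    (hF : ∀ l₁ l₂ : List ℕ, l₁.Perm l₂ → F l₁ = F l₂) :
    weightedMean θ (n + k) (fun l => (l.count k : ℝ) * F l) =
      θ k / k * weightedMean θ n (fun l => F (k :: l)) := by
  induction n using Nat.strong_induction_on generalizing F with
  | _ n ih =>
  obtain ⟨j, rfl⟩ : ∃ j, k = j + 1 := ⟨k - 1, by omega⟩
  have hne : ((n + j : ℕ) + 1 : ℝ) ≠ 0 := by positivity
  refine mul_left_cancel₀ hne ?_
  rw [← add_assoc, weightedMean_succ]
  have h1 : ∀ p ∈ antidiagonal (n + j),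
      θ (p.1 + 1) * weightedMean θ p.2
        (fun l => (((p.1 + 1) :: l).count (j + 1) : ℝ) * F ((p.1 + 1) :: l)) =
      θ (p.1 + 1) * weightedMean θ p.2
        (fun l => (l.count (j + 1) : ℝ) * F ((p.1 + 1) :: l)) +
      if p = (j, n) then θ (j + 1) * weightedMean θ n (fun l => F ((j + 1) :: l)) else 0 := by
    rintro ⟨a, b⟩ hp
    rw [mem_antidiagonal] at hp
    simp only at hp
    by_cases ha : a = j
    · obtain rfl : b = n := by omega
      subst ha
      simp only [if_true, List.count_cons_self]
      rw [← mul_add, ← weightedMean_add]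
      push_cast
      simp only [add_mul, one_mul]
    · rw [if_neg (by simp [ha]), add_zero]
      simp only
      rw [weightedMean_congr]
      intro l _
      rw [List.count_cons_of_ne (by omega)]
  rw [Finset.sum_congr rfl h1, Finset.sum_add_distrib, Finset.sum_ite_eq',
    if_pos (by rw [mem_antidiagonal]; exact add_comm _ _)]
  -- If the marked cycle is not the first one, then induction applies to the remaining cycles, and
  -- removing the first and the marked cycle in the other order gives back the recursion for `n`.
  have h2 : ∑ p ∈ antidiagonal (n + j), θ (p.1 + 1) * weightedMean θ p.2
        (fun l => (l.count (j + 1) : ℝ) * F ((p.1 + 1) :: l)) =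
      n * (θ (j + 1) / (j + 1 : ℕ) * weightedMean θ n (fun l => F ((j + 1) :: l))) := by
    cases n with
    | zero =>
      rw [Nat.cast_zero, zero_mul]
      refine Finset.sum_eq_zero fun p hp => ?_
      rw [mem_antidiagonal] at hp
      rw [weightedMean_count_of_lt _ (by omega), mul_zero]
    | succ m =>
      rw [show m + 1 + j = m + (j + 1) by ring, sum_antidiagonal_add_eq]
      · push_cast
        rw [mul_left_comm, weightedMean_succ, Finset.mul_sum]
        refine Finset.sum_congr rfl fun p hp => ?_
        rw [mem_antidiagonal] at hp
        rw [ih p.2 (by omega) _ fun l₁ l₂ h => hF _ _ (h.cons _),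
          weightedMean_congr (G := fun l => F ((j + 1) :: (p.1 + 1) :: l))
            (fun l _ => hF _ _ (List.Perm.swap _ _ _))]
        push_cast
        ring
      · intro p hp
        rw [weightedMean_count_of_lt _ hp, mul_zero]
  rw [h2]
  push_cast
  field_simp
  ring

theorem weightedMean_count (θ : ℕ → ℝ) {k : ℕ} (hk : 0 < k) (n : ℕ) :
    weightedMean θ (n + k) (fun l => (l.count k : ℝ)) = θ k / k * mass θ n := by
  have := weightedMean_count_mul θ hk n (fun _ => 1) fun _ _ _ => rfl
  simpa only [mul_one, mass] using this

theorem prod_map_update_zero (θ : ℕ → ℝ) (k : ℕ) (l : List ℕ) :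
    (l.map (Function.update θ k 0)).prod = (l.map θ).prod * if l.count k = 0 then 1 else 0 := by
  by_cases h : k ∈ l
  · have h0 : (l.map (Function.update θ k 0)).prod = 0 :=
      List.prod_eq_zero (List.mem_map.2 ⟨k, h, by simp⟩)
    rw [h0, if_neg (by rw [List.count_eq_zero]; exact not_not.2 h), mul_zero]
  · rw [if_pos (List.count_eq_zero_of_not_mem h), mul_one]
    congr 1
    refine List.map_congr_left fun a ha => Function.update_of_ne ?_ _ _
    rintro rfl
    exact h ha

/-- Removing all the cycles of length `k`, if there are `r` of them. -/
theorem weightedMean_count_eq_mul (θ : ℕ → ℝ) {k : ℕ} (hk : 0 < k) (n r : ℕ) (F : List ℕ → ℝ)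
    (hF : ∀ l₁ l₂ : List ℕ, l₁.Perm l₂ → F l₁ = F l₂) (hFk : ∀ l, F (k :: l) = F l) :
    weightedMean θ (n + k * r) (fun l => (if l.count k = r then 1 else 0) * F l) =
      (θ k / k) ^ r / r.factorial * weightedMean (Function.update θ k 0) n F := by
  induction r with
  | zero =>
    simp only [mul_zero, add_zero, pow_zero, Nat.factorial_zero, Nat.cast_one, div_one, one_mul,
      weightedMean, prod_map_update_zero, mul_assoc]
  | succ r ih =>
    have h1 : ((r : ℝ) + 1) ≠ 0 := by positivity
    refine mul_left_cancel₀ h1 ?_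
    have h2 : ((r : ℝ) + 1) * weightedMean θ (n + k * (r + 1))
          (fun l => (if l.count k = r + 1 then 1 else 0) * F l) =
        weightedMean θ (n + k * r + k)
          (fun l => (l.count k : ℝ) * ((if l.count k = r + 1 then 1 else 0) * F l)) := by
      rw [← weightedMean_const_mul, mul_add, mul_one, ← add_assoc]
      refine weightedMean_congr fun l _ => ?_
      split_ifs with h
      · rw [h]; push_cast; ring
      · ring
    rw [h2, weightedMean_count_mul _ hk]
    · simp only [List.count_cons_self, add_left_inj, hFk]
      rw [ih, Nat.factorial_succ]
      push_cast
      field_simp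
      rw [pow_succ]
      field_simp
    · intro l₁ l₂ h
      rw [h.count_eq, hF _ _ h]

/-- The decomposition of the total mass according to the number of cycles of length `k`. -/
theorem mass_eq_tsum (θ : ℕ → ℝ) {k : ℕ} (hk : 0 < k) (n : ℕ) :
    mass θ n = ∑' r : ℕ, (θ k / k) ^ r / r.factorial *
      if k * r ≤ n then mass (Function.update θ k 0) (n - k * r) else 0 := by
  have hle : ∀ r ∉ Finset.range (n + 1), ¬ k * r ≤ n := by
    intro r hr h
    rw [Finset.mem_range] at hr
    have := Nat.le_mul_of_pos_left r hk
    omega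
  rw [tsum_eq_sum (s := Finset.range (n + 1)) (fun r hr => by rw [if_neg (hle r hr), mul_zero])]
  have h1 : mass θ n = weightedMean θ n fun l =>
      ∑ r ∈ Finset.range (n + 1), if l.count k = r then 1 else 0 := by
    refine weightedMean_congr fun l hl => ?_
    rw [Finset.sum_ite_eq, if_pos]
    rw [Finset.mem_range, Nat.lt_succ_iff]
    by_contra! hcon
    have h2 : 0 < l.count k := by omega
    have h3 : l.count k * k ≤ n := by
      have := (List.replicate_sublist_iff.2 (le_refl (l.count k))).sum_le_sum
        (fun _ _ => Nat.zero_le _)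
      rwa [List.sum_replicate, smul_eq_mul, hl] at this
    have := Nat.le_mul_of_pos_right (l.count k) hk
    omega
  rw [h1, weightedMean_sum]
  refine Finset.sum_congr rfl fun r _ => ?_
  split_ifs with h
  · obtain ⟨m, rfl⟩ := Nat.exists_eq_add_of_le' h
    have := weightedMean_count_eq_mul θ hk m r (fun _ => 1) (fun _ _ _ => rfl) fun _ => rfl
    simp only [mul_one] at this
    rw [this, Nat.add_sub_cancel, mass]
  · rw [mul_zero, weightedMean_congr (G := fun _ => 0), weightedMean_const, zero_mul]
    intro l hl
    rw [if_neg]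
    rintro rfl
    refine h ?_
    have := (List.replicate_sublist_iff.2 (le_refl (l.count k))).sum_le_sum
      (fun _ _ => Nat.zero_le _)
    rwa [List.sum_replicate, smul_eq_mul, hl, mul_comm] at this

/-- The weights with those of the cycle lengths in `s` replaced by zero. -/
def zeroOn (s : Finset ℕ) (θ : ℕ → ℝ) : ℕ → ℝ :=
  fun j => if j ∈ s then 0 else θ j

/-- The joint distribution of the numbers of cycles with lengths in `s`. -/
theorem weightedMean_counts_eq (θ : ℕ → ℝ) (s : Finset ℕ) (hs : ∀ k ∈ s, 0 < k) (n : ℕ)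
    (r : ℕ → ℕ) :
    weightedMean θ (n + ∑ k ∈ s, k * r k)
      (fun l => ∏ k ∈ s, if l.count k = r k then 1 else 0) =
      (∏ k ∈ s, (θ k / k) ^ r k / (r k).factorial) * mass (zeroOn s θ) n := by
  induction s using Finset.induction_on generalizing θ with
  | empty =>
    have : zeroOn ∅ θ = θ := by ext; simp [zeroOn]
    simp [mass, this]
  | insert k s hk ih =>
    simp only [Finset.prod_insert hk]
    rw [Finset.sum_insert hk, add_comm (k * r k), ← add_assoc,
      weightedMean_count_eq_mul _ (hs k (Finset.mem_insert_self _ _)),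
      ih _ fun j hj => hs j (Finset.mem_insert_of_mem hj), ← mul_assoc]
    · have h1 : zeroOn s (Function.update θ k 0) = zeroOn (insert k s) θ := by
        ext j
        by_cases hj : j = k
        · subst hj; simp [zeroOn]
        · simp [zeroOn, hj]
      rw [h1]
      congr 2
      refine Finset.prod_congr rfl fun j hj => ?_
      rw [Function.update_of_ne]
      rintro rfl
      exact hk hj
    · intro l₁ l₂ h
      simp only [h.count_eq]
    · intro l
      refine Finset.prod_congr rfl fun j hj => ?_
      rw [List.count_cons_of_ne]
      rintro rfl
      exact hk hj

/-! ### Expectations under the weighted measure -/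

theorem coe_h_eq_mass (θ : ℕ → ℝ≥0) (n : ℕ) : (h θ n : ℝ) = mass (fun j => θ j) n := by
  simp [h, mass, weightedMean, uniformMean, weight_eq_prod, NNReal.coe_list_prod,
    Function.comp_def]

theorem integral_P (θ : ℕ → ℝ≥0) (n : ℕ) (f : Equiv.Perm (Fin n) → ℝ) :
    ∫ σ, f σ ∂(P θ n : Measure (Equiv.Perm (Fin n))) = ∑ σ, (prob θ σ : ℝ) * f σ := by
  have hP : (P θ n : Measure (Equiv.Perm (Fin n))) =
      ∑ σ : Equiv.Perm (Fin n), prob θ σ • Measure.dirac σ := by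
    rw [P, FiniteMeasure.toMeasure_sum]
    rfl
  rw [hP, integral_finsetSum_measure]
  · refine Finset.sum_congr rfl fun σ _ => ?_
    rw [integral_smul_nnreal_measure, integral_dirac]
    rfl
  · intro σ _
    exact Integrable.of_finite

theorem integral_P_eq_weightedMean (θ : ℕ → ℝ≥0) (n : ℕ) (F : List ℕ → ℝ) :
    ∫ σ, F (ageLengths σ) ∂(P θ n : Measure (Equiv.Perm (Fin n))) =
      weightedMean (fun j => θ j) n F / mass (fun j => θ j) n := by
  rw [integral_P, ← coe_h_eq_mass, weightedMean, uniformMean, Finset.mul_sum, Finset.sum_div]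
  refine Finset.sum_congr rfl fun σ _ => ?_
  simp only [prob, weight_eq_prod]
  push_cast
  rw [List.map_map, Function.comp_def, one_div, mul_inv]
  ring

/-! ### Asymptotics of the normalizations -/

/-- Toeplitz's theorem on averages: the weights are bounded in sum, and each of them tends to zero, so
a null sequence is averaged to zero. -/
theorem tendsto_sum_weights_mul_zero {w : ℕ → ℕ → ℝ} {a : ℕ → ℝ} {s : ℕ → Finset ℕ} {M : ℝ}
    (hw : ∀ n i, 0 ≤ w n i) (hM : ∀ᶠ n in atTop, ∑ i ∈ s n, w n i ≤ M)
    (hz : ∀ i, Tendsto (fun n => w n i) atTop (𝓝 0)) (ha : Tendsto a atTop (𝓝 0)) :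
    Tendsto (fun n => ∑ i ∈ s n, w n i * a i) atTop (𝓝 0) := by
  rw [Metric.tendsto_atTop']
  intro ε hε
  obtain ⟨ε', hε', hεM⟩ : ∃ ε' > 0, ε' * M < ε / 2 := by
    refine ⟨ε / (2 * (|M| + 1)), by positivity, ?_⟩
    have h1 : M < |M| + 1 := (le_abs_self M).trans_lt (lt_add_one _)
    calc ε / (2 * (|M| + 1)) * M < ε / (2 * (|M| + 1)) * (|M| + 1) := by gcongr
      _ = ε / 2 := by field_simp
  obtain ⟨J, hJ⟩ := Metric.tendsto_atTop.1 ha ε' hε'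
  have hfin : Tendsto (fun n => ∑ i ∈ Finset.range J, w n i * |a i|) atTop (𝓝 0) := by
    have := tendsto_finsetSum (Finset.range J) fun i _ => (hz i).mul_const |a i|
    simpa using this
  obtain ⟨N, hN⟩ := eventually_atTop.1 (hM.and (hfin.eventually (gt_mem_nhds (half_pos hε))))
  refine ⟨N, fun n hn => ?_⟩
  obtain ⟨h1, h2⟩ := hN n hn.le
  rw [Real.dist_0_eq_abs]
  calc |∑ i ∈ s n, w n i * a i| ≤ ∑ i ∈ s n, |w n i * a i| := Finset.abs_sum_le_sum_abs _ _
    _ ≤ ∑ i ∈ s n, (w n i * ε' + if i ∈ Finset.range J then w n i * |a i| else 0) := by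
        refine Finset.sum_le_sum fun i _ => ?_
        rw [abs_mul, abs_of_nonneg (hw n i)]
        split_ifs with hi
        · exact le_add_of_nonneg_left (mul_nonneg (hw n i) hε'.le)
        · rw [add_zero]
          refine mul_le_mul_of_nonneg_left ?_ (hw n i)
          have := hJ i (by simpa using hi)
          rw [Real.dist_0_eq_abs] at this
          exact this.le
    _ = (∑ i ∈ s n, w n i) * ε' + ∑ i ∈ s n ∩ Finset.range J, w n i * |a i| := by
        rw [Finset.sum_add_distrib, ← Finset.sum_mul, Finset.sum_ite_mem]
    _ ≤ M * ε' + ∑ i ∈ Finset.range J, w n i * |a i| := by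
        gcongr
        · exact fun i _ _ => mul_nonneg (hw n i) (abs_nonneg _)
        · exact Finset.inter_subset_right
    _ < ε := by linarith [mul_comm ε' M]

/-- The Stolz–Cesàro theorem. -/
theorem tendsto_weighted_average {v r : ℕ → ℝ} {ρ : ℝ} (hv : ∀ n, 0 ≤ v n)
    (hV : Tendsto (fun n => ∑ i ∈ Finset.range n, v i) atTop atTop)
    (hr : Tendsto r atTop (𝓝 ρ)) :
    Tendsto (fun n => (∑ i ∈ Finset.range n, v i * r i) / ∑ i ∈ Finset.range n, v i) atTop
      (𝓝 ρ) := by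
  have hV0 : ∀ n, 0 ≤ ∑ i ∈ Finset.range n, v i := fun n => Finset.sum_nonneg fun i _ => hv i
  have h := tendsto_sum_weights_mul_zero (w := fun n i => v i / ∑ i ∈ Finset.range n, v i)
    (a := fun i => r i - ρ) (s := Finset.range) (M := 1) (fun n i => div_nonneg (hv i) (hV0 n))
    (Eventually.of_forall fun n => by rw [← Finset.sum_div]; exact div_self_le_one _)
    (fun i => hV.const_div_atTop _) (by simpa using hr.sub_const ρ)
  have h2 := h.add_const ρ
  rw [zero_add] at h2
  refine h2.congr' ?_
  filter_upwards [hV.eventually_gt_atTop 0] with n hn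
  simp only [mul_sub, Finset.sum_sub_distrib, div_mul_eq_mul_div]
  rw [← Finset.sum_div, ← Finset.sum_div, ← Finset.sum_mul]
  field_simp
  ring

/-- Nonnegative cycle weights that converge to the positive number `ϑ`. -/
structure ConvergentWeights (θ : ℕ → ℝ) (ϑ : ℝ) : Prop where
  nonneg : ∀ j, 0 ≤ θ j
  pos : 0 < ϑ
  tendsto : Tendsto θ atTop (𝓝 ϑ)

/-- The partial sums of the normalizations. -/
noncomputable def cumMass (θ : ℕ → ℝ) (n : ℕ) : ℝ :=
  ∑ k ∈ Finset.range n, mass θ k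

theorem sum_antidiagonal_snd (q : ℕ → ℝ) (n : ℕ) :
    ∑ p ∈ antidiagonal n, q p.2 = ∑ m ∈ Finset.range (n + 1), q m := by
  rw [← Finset.Nat.sum_antidiagonal_swap, Finset.Nat.sum_antidiagonal_eq_sum_range_succ_mk]
  rfl

theorem sum_antidiagonal_mass (θ : ℕ → ℝ) (n : ℕ) :
    ∑ p ∈ antidiagonal n, mass θ p.2 = cumMass θ (n + 1) :=
  sum_antidiagonal_snd _ _

namespace ConvergentWeights

variable {θ : ℕ → ℝ} {ϑ : ℝ}

theorem exists_bound (hw : ConvergentWeights θ ϑ) : ∃ C, 0 < C ∧ ∀ j, θ j ≤ C := by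
  obtain ⟨C, hC⟩ := hw.tendsto.bddAbove_range
  refine ⟨max C 1, by positivity, fun j => le_max_of_le_left (hC ⟨j, rfl⟩)⟩

theorem mass_nonneg (hw : ConvergentWeights θ ϑ) (n : ℕ) : 0 ≤ mass θ n :=
  WeightedPerm.mass_nonneg hw.nonneg n

theorem cumMass_mono (hw : ConvergentWeights θ ϑ) : Monotone (cumMass θ) := fun _ _ h =>
  Finset.sum_le_sum_of_subset_of_nonneg (Finset.range_mono h) fun _ _ _ => hw.mass_nonneg _

theorem one_le_cumMass (hw : ConvergentWeights θ ϑ) {n : ℕ} (hn : 0 < n) : 1 ≤ cumMass θ n :=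
  (show 1 ≤ cumMass θ 1 by simp [cumMass, mass_zero]).trans (hw.cumMass_mono hn)

theorem cumMass_nonneg (hw : ConvergentWeights θ ϑ) (n : ℕ) : 0 ≤ cumMass θ n :=
  Finset.sum_nonneg fun _ _ => hw.mass_nonneg _

/-- The masses do not concentrate: a single mass is at most of order `1 / n` relative to the sum. -/
theorem mul_mass_le (hw : ConvergentWeights θ ϑ) {C : ℝ} (hC : ∀ j, θ j ≤ C) (n : ℕ) :
    n * mass θ n ≤ C * cumMass θ n := by
  cases n with
  | zero => simp [cumMass]
  | succ n =>
    push_cast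
    rw [mass_succ, ← sum_antidiagonal_mass, Finset.mul_sum]
    exact Finset.sum_le_sum fun p _ => mul_le_mul_of_nonneg_right (hC _) (hw.mass_nonneg _)

theorem tendsto_mass_div_cumMass (hw : ConvergentWeights θ ϑ) (k : ℕ) :
    Tendsto (fun n => mass θ n / cumMass θ (n + k)) atTop (𝓝 0) := by
  obtain ⟨C, hC0, hC⟩ := hw.exists_bound
  refine squeeze_zero' (Eventually.of_forall fun n => div_nonneg (hw.mass_nonneg _)
    (hw.cumMass_nonneg _)) ?_ (tendsto_const_div_atTop_nhds_zero_nat C)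
  filter_upwards [eventually_gt_atTop 0] with n hn
  have h1 := hw.one_le_cumMass (n := n + k) (by omega)
  have h2 := hw.mul_mass_le hC n
  have h3 := hw.cumMass_mono (Nat.le_add_right n k)
  have hn' : (0 : ℝ) < n := by exact_mod_cast hn
  rw [div_le_div_iff₀ (by linarith) hn']
  nlinarith

/-- The weights may be replaced by their limit in the recursion: since the masses do not
concentrate on the last few indices, only weights with large index matter. -/
theorem tendsto_sum_abs_sub (hw : ConvergentWeights θ ϑ) :
    Tendsto (fun n => (∑ p ∈ antidiagonal n, |θ (p.1 + 1) - ϑ| * mass θ p.2) / cumMass θ (n + 1))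
      atTop (𝓝 0) := by
  have h := tendsto_sum_weights_mul_zero (w := fun n i => mass θ (n - i) / cumMass θ (n + 1))
    (a := fun i => |θ (i + 1) - ϑ|) (s := fun n => Finset.range (n + 1)) (M := 1)
    (fun n i => div_nonneg (hw.mass_nonneg _) (hw.cumMass_nonneg _)) ?_ ?_ ?_
  · refine h.congr fun n => ?_
    rw [Finset.Nat.sum_antidiagonal_eq_sum_range_succ_mk, Finset.sum_div]
    exact Finset.sum_congr rfl fun i _ => by ring
  · refine Eventually.of_forall fun n => ?_
    rw [← Finset.sum_div, ← sum_antidiagonal_mass, Finset.Nat.sum_antidiagonal_eq_sum_range_succ_mk]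
    exact div_self_le_one _
  · intro i
    rw [← tendsto_add_atTop_iff_nat i]
    refine (hw.tendsto_mass_div_cumMass (i + 1)).congr fun n => ?_
    rw [Nat.add_sub_cancel, add_assoc]
  · have := ((tendsto_add_atTop_iff_nat 1).2 hw.tendsto).sub_const ϑ
    simpa using this.abs

theorem tendsto_sum_sub_mul (hw : ConvergentWeights θ ϑ) {q : ℕ → ℕ → ℝ}
    (hq : ∀ n, ∀ m ≤ n, |q n m| ≤ mass θ m) :
    Tendsto (fun n => (∑ p ∈ antidiagonal n, (θ (p.1 + 1) - ϑ) * q n p.2) / cumMass θ (n + 1))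
      atTop (𝓝 0) := by
  refine squeeze_zero_norm (fun n => ?_) hw.tendsto_sum_abs_sub
  rw [Real.norm_eq_abs, abs_div, abs_of_nonneg (hw.cumMass_nonneg _)]
  refine div_le_div_of_nonneg_right ((Finset.abs_sum_le_sum_abs _ _).trans
    (Finset.sum_le_sum fun p hp => ?_)) (hw.cumMass_nonneg _)
  rw [mem_antidiagonal] at hp
  rw [abs_mul]
  exact mul_le_mul_of_nonneg_left (hq n _ (by omega)) (abs_nonneg _)

/-- The basic asymptotic relation, from which all the regularity of the masses is derived. -/
theorem tendsto_mul_mass_div_cumMass (hw : ConvergentWeights θ ϑ) :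
    Tendsto (fun n : ℕ => n * mass θ n / cumMass θ n) atTop (𝓝 ϑ) := by
  rw [← tendsto_add_atTop_iff_nat 1]
  have h := (hw.tendsto_sum_sub_mul (q := fun _ => mass θ) fun n m _ =>
    (abs_of_nonneg (hw.mass_nonneg m)).le).add_const ϑ
  rw [zero_add] at h
  refine h.congr fun n => ?_
  have h1 : cumMass θ (n + 1) ≠ 0 :=
    (zero_lt_one.trans_le (hw.one_le_cumMass n.succ_pos)).ne'
  push_cast
  rw [mass_succ]
  simp only [sub_mul, Finset.sum_sub_distrib]
  rw [← Finset.mul_sum, sum_antidiagonal_mass]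
  field_simp
  ring

theorem eventually_le_mass (hw : ConvergentWeights θ ϑ) :
    ∀ᶠ n : ℕ in atTop, ϑ / 2 * cumMass θ n ≤ n * mass θ n := by
  filter_upwards [hw.tendsto_mul_mass_div_cumMass.eventually
    (lt_mem_nhds (half_lt_self hw.pos)), eventually_gt_atTop 0] with n hn hn0
  rw [lt_div_iff₀ (zero_lt_one.trans_le (hw.one_le_cumMass hn0))] at hn
  exact hn.le

theorem eventually_mass_pos (hw : ConvergentWeights θ ϑ) : ∀ᶠ n in atTop, 0 < mass θ n := by
  filter_upwards [hw.eventually_le_mass, eventually_gt_atTop 0] with n hn hn0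
  have h1 := hw.one_le_cumMass hn0
  have h2 := hw.pos
  have h3 : 0 < (n : ℝ) * mass θ n := by nlinarith
  exact pos_of_mul_pos_right h3 n.cast_nonneg

theorem tendsto_cumMass (hw : ConvergentWeights θ ϑ) : Tendsto (cumMass θ) atTop atTop := by
  refine (not_summable_iff_tendsto_nat_atTop_of_nonneg hw.mass_nonneg).1 fun hs => ?_
  refine Real.not_summable_natCast_inv ?_
  have hs2 := hs.mul_left (2 / ϑ)
  refine hs2.of_norm_bounded_eventually_nat ?_
  filter_upwards [hw.eventually_le_mass, eventually_gt_atTop 0] with n hn hn0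
  have h1 := hw.one_le_cumMass hn0
  have h2 := hw.pos
  have hn' : (0 : ℝ) < n := by exact_mod_cast hn0
  rw [Real.norm_of_nonneg (by positivity), inv_eq_one_div, div_le_iff₀ hn', div_mul_eq_mul_div,
    div_mul_eq_mul_div, le_div_iff₀ h2]
  nlinarith

theorem tendsto_cumMass_succ_div (hw : ConvergentWeights θ ϑ) :
    Tendsto (fun n => cumMass θ (n + 1) / cumMass θ n) atTop (𝓝 1) := by
  have := (hw.tendsto_mass_div_cumMass 0).const_add 1
  rw [add_zero] at this
  refine this.congr' ?_
  filter_upwards [eventually_gt_atTop 0] with n hn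
  have h1 := hw.one_le_cumMass hn
  have h2 : cumMass θ n ≠ 0 := by positivity
  rw [add_zero, show cumMass θ (n + 1) = cumMass θ n + mass θ n from Finset.sum_range_succ _ _]
  field_simp

theorem tendsto_mass_succ_div (hw : ConvergentWeights θ ϑ) :
    Tendsto (fun n => mass θ (n + 1) / mass θ n) atTop (𝓝 1) := by
  have h1 := ((tendsto_add_atTop_iff_nat 1).2 hw.tendsto_mul_mass_div_cumMass).div
    hw.tendsto_mul_mass_div_cumMass hw.pos.ne'
  have h2 := (h1.mul hw.tendsto_cumMass_succ_div).mul (tendsto_natCast_div_add_atTop (1 : ℝ))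
  rw [div_self hw.pos.ne', one_mul, one_mul] at h2
  refine h2.congr' ?_
  filter_upwards [eventually_gt_atTop 0, hw.eventually_mass_pos] with n hn hm
  have h3 := hw.one_le_cumMass hn
  have h4 := hw.one_le_cumMass n.succ_pos
  have h5 : cumMass θ n ≠ 0 := by positivity
  have h6 : cumMass θ (n + 1) ≠ 0 := by positivity
  have hn' : (n : ℝ) ≠ 0 := by positivity
  have hn2 : (n : ℝ) + 1 ≠ 0 := by positivity
  simp only [Pi.div_apply]
  push_cast
  field_simp

theorem tendsto_mass_div_mass_add (hw : ConvergentWeights θ ϑ) (k : ℕ) :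
    Tendsto (fun n => mass θ n / mass θ (n + k)) atTop (𝓝 1) := by
  induction k with
  | zero =>
    refine tendsto_const_nhds.congr' ?_
    filter_upwards [hw.eventually_mass_pos] with n hn
    exact (div_self hn.ne').symm
  | succ k ih =>
    have h1 := ih.mul (((tendsto_add_atTop_iff_nat k).2 hw.tendsto_mass_succ_div).inv₀ one_ne_zero)
    rw [inv_one, mul_one] at h1
    refine h1.congr' ?_
    filter_upwards [(tendsto_add_atTop_nat k).eventually hw.eventually_mass_pos] with n hn
    rw [inv_div, div_mul_div_cancel₀ hn.ne', add_assoc]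

/-- The domination that justifies summing over the number of cycles of a given length. -/
theorem exists_mass_sub_le (hw : ConvergentWeights θ ϑ) :
    ∃ C, 0 < C ∧ ∀ᶠ n in atTop, ∀ k ≤ n, mass θ (n - k) ≤ C * (k + 1) * mass θ n := by
  obtain ⟨C, hC0, hC⟩ := hw.exists_bound
  have hϑ := hw.pos
  refine ⟨max C 1 * (2 / ϑ), by positivity, ?_⟩
  filter_upwards [hw.eventually_le_mass, eventually_gt_atTop 0] with n hn hn0 k hk
  have h1 := hw.one_le_cumMass hn0
  have hn1 : cumMass θ n ≤ 2 / ϑ * (n * mass θ n) := by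
    rw [div_mul_eq_mul_div, le_div_iff₀ hϑ]; linarith
  have hm := hw.mass_nonneg n
  have hM : 1 ≤ max C 1 := le_max_right _ _
  -- The bound `m * mass θ m ≤ C * cumMass θ m` says nothing for `m = n - k = 0`, where the mass is one.
  rcases hk.eq_or_lt with rfl | hlt
  · rw [Nat.sub_self, mass_zero]
    have h2 : 2 / ϑ * (k * mass θ k) ≤ max C 1 * (2 / ϑ * ((k + 1) * mass θ k)) := by
      have h3 : 0 ≤ 2 / ϑ * ((k + 1) * mass θ k) := by positivity
      calc 2 / ϑ * (k * mass θ k) ≤ 2 / ϑ * ((k + 1) * mass θ k) := by gcongr; linarith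
        _ ≤ _ := le_mul_of_one_le_left h3 hM
    calc (1 : ℝ) ≤ cumMass θ k := h1
      _ ≤ _ := hn1
      _ ≤ _ := h2
      _ = _ := by ring
  · have hnk : (0 : ℝ) < (n - k : ℕ) := by exact_mod_cast Nat.sub_pos_of_lt hlt
    have h2 : ((n - k : ℕ) : ℝ) * mass θ (n - k) ≤ max C 1 * cumMass θ n :=
      (hw.mul_mass_le hC _).trans (mul_le_mul (le_max_left _ _) (hw.cumMass_mono (Nat.sub_le _ _))
        (hw.cumMass_nonneg _) (by positivity))
    have h3 : (n : ℝ) ≤ (k + 1) * (n - k : ℕ) := by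
      have : 1 ≤ n - k := Nat.sub_pos_of_lt hlt
      have h4 : n ≤ (k + 1) * (n - k) := by
        calc n = k + (n - k) := by omega
          _ ≤ k * (n - k) + (n - k) := by gcongr; exact Nat.le_mul_of_pos_right _ this
          _ = _ := by ring
      exact_mod_cast h4
    refine le_of_mul_le_mul_left ?_ hnk
    calc ((n - k : ℕ) : ℝ) * mass θ (n - k) ≤ max C 1 * cumMass θ n := h2
      _ ≤ max C 1 * (2 / ϑ * (n * mass θ n)) := by gcongr
      _ ≤ max C 1 * (2 / ϑ * ((k + 1) * (n - k : ℕ) * mass θ n)) := by gcongr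
      _ = _ := by ring

theorem tendsto_mul_one_add_inv_pow_sub_one (B : ℕ) :
    Tendsto (fun n : ℕ => (n : ℝ) * ((1 + 1 / (n : ℝ)) ^ B - 1)) atTop (𝓝 B) := by
  induction B with
  | zero => simp
  | succ B ih =>
    have h1 : Tendsto (fun n : ℕ => 1 + 1 / (n : ℝ)) atTop (𝓝 1) := by
      simpa using tendsto_one_div_atTop_nhds_zero_nat.const_add (1 : ℝ)
    have h2 := (ih.mul h1).add_const 1
    rw [mul_one] at h2
    push_cast
    refine h2.congr' ?_
    filter_upwards [eventually_gt_atTop 0] with n hn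
    have : (n : ℝ) ≠ 0 := by positivity
    rw [pow_succ]
    field_simp
    ring

/-- The Stolz–Cesàro theorem, applied to the increments of `n ^ B * cumMass θ n`. -/
theorem tendsto_sum_div_cumMass (hw : ConvergentWeights θ ϑ) {B : ℕ} {q : ℕ → ℝ} {ℓ : ℝ}
    (hq0 : ∀ m, 0 ≤ q m) (hq : ∀ m : ℕ, q m ≤ (m : ℝ) ^ B * mass θ m)
    (hlim : Tendsto (fun m : ℕ => q m / ((m : ℝ) ^ B * mass θ m)) atTop (𝓝 ℓ)) :
    Tendsto (fun n : ℕ => (∑ m ∈ Finset.range n, q m) / ((n : ℝ) ^ B * cumMass θ n)) atTop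
      (𝓝 (ℓ * ϑ / (ϑ + B))) := by
  set v : ℕ → ℝ := fun m => (m + 1 : ℝ) ^ B * cumMass θ (m + 1) - (m : ℝ) ^ B * cumMass θ m with hv
  have hsum : ∀ n : ℕ, ∑ i ∈ Finset.range n, v i = (n : ℝ) ^ B * cumMass θ n := by
    intro n
    have := Finset.sum_range_sub (fun m : ℕ => (m : ℝ) ^ B * cumMass θ m) n
    simp only [hv]
    push_cast at this
    rw [this]
    simp [cumMass]
  have hveq : ∀ m : ℕ, v m = (m + 1 : ℝ) ^ B * mass θ m +
      ((m + 1 : ℝ) ^ B - (m : ℝ) ^ B) * cumMass θ m := by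
    intro m
    simp only [hv]
    rw [show cumMass θ (m + 1) = cumMass θ m + mass θ m from Finset.sum_range_succ _ _]
    ring
  have hqv : ∀ m, q m ≤ v m := by
    intro m
    rw [hveq]
    have h1 : (m : ℝ) ^ B ≤ (m + 1 : ℝ) ^ B := by gcongr; linarith
    have h2 := hw.cumMass_nonneg m
    have h3 := hw.mass_nonneg m
    have h4 := hq m
    nlinarith [mul_le_mul_of_nonneg_right h1 h3, mul_nonneg (sub_nonneg.2 h1) h2]
  have hV : Tendsto (fun n => ∑ i ∈ Finset.range n, v i) atTop atTop := by
    refine tendsto_atTop_mono' _ ?_ hw.tendsto_cumMass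
    filter_upwards [eventually_gt_atTop 0] with n hn
    rw [hsum]
    refine le_mul_of_one_le_left (hw.cumMass_nonneg n) (one_le_pow₀ ?_)
    exact_mod_cast hn
  have hvlim : Tendsto (fun m : ℕ => v m / ((m : ℝ) ^ B * mass θ m)) atTop (𝓝 (1 + B / ϑ)) := by
    have h1 : Tendsto (fun n : ℕ => (1 + 1 / (n : ℝ)) ^ B) atTop (𝓝 1) := by
      simpa using (tendsto_one_div_atTop_nhds_zero_nat.const_add (1 : ℝ)).pow B
    have h2 := h1.add ((tendsto_mul_one_add_inv_pow_sub_one B).div hw.tendsto_mul_mass_div_cumMass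
      hw.pos.ne')
    refine h2.congr' ?_
    filter_upwards [eventually_gt_atTop 0, hw.eventually_mass_pos] with n hn hm
    have h3 := hw.one_le_cumMass hn
    have h4 : cumMass θ n ≠ 0 := by positivity
    have h5 : (n : ℝ) ≠ 0 := by positivity
    rw [hveq]
    simp only [Pi.div_apply]
    rw [show (1 + 1 / (n : ℝ)) = (n + 1) / n by field_simp, div_pow]
    field_simp
  have hne : 1 + B / ϑ ≠ 0 := by have := hw.pos; positivity
  have hr := hlim.div hvlim hne
  have h := tendsto_weighted_average (v := v) (r := fun m => q m / v m)
    (fun n => (hq0 n).trans (hqv n)) hV (ρ := ℓ / (1 + B / ϑ)) ?_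
  · have hpos := hw.pos
    have hval : ℓ / (1 + B / ϑ) = ℓ * ϑ / (ϑ + B) := by field_simp
    rw [hval] at h
    refine h.congr fun n => ?_
    rw [hsum]
    congr 1
    refine Finset.sum_congr rfl fun m _ => ?_
    -- If the increment `v m` vanishes, then so does `q m`, which it dominates.
    rcases eq_or_ne (v m) 0 with h0 | h0
    · have := hqv m
      have := hq0 m
      rw [h0, zero_mul]
      linarith
    · field_simp
  · refine hr.congr' ?_
    filter_upwards [eventually_gt_atTop 0, hw.eventually_mass_pos] with n hn hm
    have h5 : (n : ℝ) ≠ 0 := by positivity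
    simp only [Pi.div_apply]
    field_simp

/-- The renewal-type limit behind the stick-breaking structure: the remaining fraction after the
first cycle, weighted with a sequence that converges, has the moments of a beta distribution. -/
theorem tendsto_sum_weights_mul (hw : ConvergentWeights θ ϑ) {B : ℕ} {q : ℕ → ℝ} {ℓ : ℝ}
    (hq0 : ∀ m, 0 ≤ q m) (hq : ∀ m : ℕ, q m ≤ (m : ℝ) ^ B * mass θ m)
    (hlim : Tendsto (fun m : ℕ => q m / ((m : ℝ) ^ B * mass θ m)) atTop (𝓝 ℓ)) :
    Tendsto (fun n : ℕ => (∑ p ∈ antidiagonal n, θ (p.1 + 1) * q p.2) /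
      ((n + 1 : ℝ) * ((n + 1 : ℝ) ^ B * mass θ (n + 1)))) atTop (𝓝 (ℓ * ϑ / (ϑ + B))) := by
  have hpos := hw.pos
  have h1 := hw.tendsto_sum_sub_mul (q := fun n m => q m / (n + 1 : ℝ) ^ B) fun n m hm => by
    rw [abs_of_nonneg (by have := hq0 m; positivity), div_le_iff₀ (by positivity), mul_comm]
    refine (hq m).trans (mul_le_mul_of_nonneg_right ?_ (hw.mass_nonneg m))
    have : (m : ℝ) ≤ n + 1 := by exact_mod_cast Nat.le_succ_of_le hm
    gcongr
  have h2 := (tendsto_add_atTop_iff_nat 1).2 (hw.tendsto_sum_div_cumMass hq0 hq hlim)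
  have h3 := (h1.add (h2.const_mul ϑ)).div
    ((tendsto_add_atTop_iff_nat 1).2 hw.tendsto_mul_mass_div_cumMass) hpos.ne'
  rw [zero_add, mul_div_cancel_left₀ _ hpos.ne'] at h3
  refine h3.congr' ?_
  filter_upwards [(tendsto_add_atTop_nat 1).eventually hw.eventually_mass_pos] with n hm
  have h4 : cumMass θ (n + 1) ≠ 0 :=
    (zero_lt_one.trans_le (hw.one_le_cumMass n.succ_pos)).ne'
  have hn : (n : ℝ) + 1 ≠ 0 := by positivity
  simp only [Pi.div_apply, mul_div_assoc']
  rw [← Finset.sum_div]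
  simp only [sub_mul, Finset.sum_sub_distrib]
  rw [← Finset.mul_sum, sum_antidiagonal_snd]
  push_cast
  field_simp
  ring

end ConvergentWeights

/-! ### Numbers of cycles of given lengths -/

namespace ConvergentWeights

variable {θ : ℕ → ℝ} {ϑ : ℝ}

/-- The filter of pairs `(n, j)` such that `n` tends to infinity and `j / n` tends to zero. -/
noncomputable def smallFraction : Filter (ℕ × ℕ) :=
  comap Prod.fst atTop ⊓ comap (fun p : ℕ × ℕ => (p.2 : ℝ) / p.1) (𝓝 0)

/-- Uniformly for `j` small compared with `n`, the masses at `n - j` and at `n` are asymptotically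
equal. -/
theorem tendsto_mass_sub_div (hw : ConvergentWeights θ ϑ) :
    Tendsto (fun p : ℕ × ℕ => mass θ (p.1 - p.2) / mass θ p.1) smallFraction (𝓝 1) := by
  obtain ⟨C, hC0, hC⟩ := hw.exists_bound
  have hfst : Tendsto (Prod.fst : ℕ × ℕ → ℕ) smallFraction atTop :=
    tendsto_comap.mono_left inf_le_left
  have hfrac : Tendsto (fun p : ℕ × ℕ => (p.2 : ℝ) / p.1) smallFraction (𝓝 0) :=
    tendsto_comap.mono_left inf_le_right
  have hhalf : ∀ᶠ p : ℕ × ℕ in smallFraction, 0 < p.1 ∧ 2 * p.2 < p.1 := by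
    filter_upwards [hfst.eventually_gt_atTop 0, hfrac.eventually (gt_mem_nhds one_half_pos)]
      with p hp hp2
    have hp' : (0 : ℝ) < p.1 := by exact_mod_cast hp
    rw [div_lt_iff₀ hp'] at hp2
    refine ⟨hp, ?_⟩
    have : (2 : ℝ) * p.2 < p.1 := by linarith
    exact_mod_cast this
  have hsub : Tendsto (fun p : ℕ × ℕ => p.1 - p.2) smallFraction atTop := by
    refine tendsto_atTop.2 fun b => ?_
    filter_upwards [hhalf, hfst.eventually_ge_atTop (2 * b)] with p hp hp2
    omega
  have hinv : Tendsto (fun p : ℕ × ℕ => (1 - (p.2 : ℝ) / p.1)⁻¹) smallFraction (𝓝 1) := by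
    simpa using (hfrac.const_sub 1).inv₀ (by norm_num)
  have hcum : Tendsto (fun p : ℕ × ℕ => cumMass θ (p.1 - p.2) / cumMass θ p.1) smallFraction
      (𝓝 1) := by
    have hlow : Tendsto (fun p : ℕ × ℕ => 1 - C * ((p.2 : ℝ) / p.1 * (1 - (p.2 : ℝ) / p.1)⁻¹))
        smallFraction (𝓝 1) := by
      simpa using ((hfrac.mul hinv).const_mul C).const_sub 1
    refine tendsto_of_tendsto_of_tendsto_of_le_of_le' hlow tendsto_const_nhds ?_ ?_
    · filter_upwards [hhalf] with ⟨n, j⟩ ⟨hn, hj⟩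
      simp only at hn hj ⊢
      have h1 : 0 < cumMass θ n := zero_lt_one.trans_le (hw.one_le_cumMass hn)
      have hn' : (0 : ℝ) < n := by exact_mod_cast hn
      have hj' : (0 : ℝ) < (n : ℝ) - j := by
        have : (j : ℝ) < n := by exact_mod_cast (by omega : j < n)
        linarith
      have h2 : cumMass θ n = cumMass θ (n - j) + ∑ k ∈ Finset.Ico (n - j) n, mass θ k :=
        (Finset.sum_range_add_sum_Ico _ (Nat.sub_le n j)).symm
      have h3 : ∑ k ∈ Finset.Ico (n - j) n, mass θ k ≤ j * (C * cumMass θ n / (n - j)) := by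
        have : ∀ k ∈ Finset.Ico (n - j) n, mass θ k ≤ C * cumMass θ n / (n - j) := by
          intro k hk
          rw [Finset.mem_Ico] at hk
          rw [le_div_iff₀ hj']
          have hk1 : (n : ℝ) - j ≤ k := by
            have : (n : ℝ) ≤ k + j := by exact_mod_cast (by omega : n ≤ k + j)
            linarith
          calc mass θ k * (n - j) ≤ mass θ k * k :=
                mul_le_mul_of_nonneg_left hk1 (hw.mass_nonneg k)
            _ = k * mass θ k := mul_comm _ _
            _ ≤ C * cumMass θ k := hw.mul_mass_le hC k
            _ ≤ C * cumMass θ n := by gcongr; exact hw.cumMass_mono hk.2.le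
        refine (Finset.sum_le_card_nsmul _ _ _ this).trans_eq ?_
        rw [Nat.card_Ico, nsmul_eq_mul]
        congr 2
        omega
      have h4 : (j : ℝ) / n * (1 - (j : ℝ) / n)⁻¹ = j / (n - j) := by
        rw [one_sub_div hn'.ne', inv_div]
        field_simp
      rw [h4, le_div_iff₀ h1]
      have h5 : j * (C * cumMass θ n / (n - j)) = C * (j / (n - j)) * cumMass θ n := by ring
      linarith
    · filter_upwards with p
      exact div_le_one_of_le₀ (hw.cumMass_mono (Nat.sub_le _ _)) (hw.cumMass_nonneg _)
  have hτ := (hw.tendsto_mul_mass_div_cumMass.comp hsub).div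
    (hw.tendsto_mul_mass_div_cumMass.comp hfst) hw.pos.ne'
  have h := (hτ.mul hinv).mul hcum
  rw [div_self hw.pos.ne', one_mul, one_mul] at h
  refine h.congr' ?_
  filter_upwards [hhalf, hfst.eventually hw.eventually_mass_pos] with ⟨n, j⟩ ⟨hn, hj⟩ hm
  simp only at hn hj hm
  have h1 := hw.one_le_cumMass hn
  have h2 := hw.one_le_cumMass (n := n - j) (by omega)
  have h3 : cumMass θ n ≠ 0 := by positivity
  have h4 : cumMass θ (n - j) ≠ 0 := by positivity
  have hn' : (n : ℝ) ≠ 0 := by positivity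
  have hj' : (n : ℝ) - j ≠ 0 := by
    have : (j : ℝ) < n := by exact_mod_cast (by omega : j < n)
    linarith
  simp only [Pi.div_apply, Function.comp_apply]
  rw [Nat.cast_sub (by omega), one_sub_div hn', inv_div]
  field_simp

/-- The mass changes little if the index is changed by a small fraction. -/
theorem exists_abs_mass_sub_div_le (hw : ConvergentWeights θ ϑ) {ε : ℝ} (hε : 0 < ε) :
    ∃ δ > 0, ∀ᶠ n : ℕ in atTop, ∀ j : ℕ, (j : ℝ) ≤ δ * n →
      |mass θ (n - j) / mass θ n - 1| ≤ ε := by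
  have h := hw.tendsto_mass_sub_div.eventually (Metric.closedBall_mem_nhds 1 hε)
  obtain ⟨⟨N, δ⟩, ⟨-, hδ⟩, hN⟩ := ((atTop_basis.comap Prod.fst).inf
    (Metric.nhds_basis_ball.comap fun p : ℕ × ℕ => (p.2 : ℝ) / p.1)).eventually_iff.1 h
  refine ⟨δ / 2, half_pos hδ, ?_⟩
  filter_upwards [eventually_ge_atTop N, eventually_gt_atTop 0] with n hn hn0 j hj
  have hn' : (0 : ℝ) < n := by exact_mod_cast hn0
  have h1 := hN (x := (n, j)) ⟨hn, by
    simp only [Set.mem_preimage, Metric.mem_ball, Real.dist_0_eq_abs]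
    rw [abs_of_nonneg (by positivity), div_lt_iff₀ hn']
    have := mul_lt_mul_of_pos_right (half_lt_self hδ) hn'
    linarith⟩
  rwa [Real.dist_eq] at h1

theorem tendsto_harmonic_div_log :
    Tendsto (fun n : ℕ => (∑ i ∈ Finset.range n, 1 / ((i : ℝ) + 1)) / Real.log n) atTop (𝓝 1) := by
  have hlog : Tendsto (fun n : ℕ => Real.log n) atTop atTop :=
    Real.tendsto_log_atTop.comp tendsto_natCast_atTop_atTop
  have h := (Real.tendsto_harmonic_sub_log.div_atTop hlog).add_const 1
  rw [zero_add] at h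
  refine h.congr' ?_
  filter_upwards [hlog.eventually_gt_atTop 0] with n hn
  rw [sub_div, div_self hn.ne', sub_add_cancel, harmonic]
  push_cast
  simp

/-- The sum is compared with `∑ θ j / j`: for `j ≤ δ n` the ratio of the masses is close to one, and the
terms with `j > δ n` contribute a bounded amount. -/
theorem tendsto_mean_cycles_div_log (hw : ConvergentWeights θ ϑ) :
    Tendsto (fun n : ℕ => (∑ i ∈ Finset.range n,
      θ (i + 1) / ((i : ℝ) + 1) * (mass θ (n - (i + 1)) / mass θ n)) / Real.log n) atTop
      (𝓝 ϑ) := by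
  obtain ⟨C, hC0, hC⟩ := hw.exists_bound
  have hϑ := hw.pos
  set H : ℕ → ℝ := fun n => ∑ i ∈ Finset.range n, 1 / ((i : ℝ) + 1) with hH
  have hHtop : Tendsto H atTop atTop := Real.tendsto_sum_range_one_div_nat_succ_atTop
  have h1 : Tendsto (fun n => (∑ i ∈ Finset.range n, 1 / ((i : ℝ) + 1) * θ (i + 1)) / H n) atTop
      (𝓝 ϑ) :=
    tendsto_weighted_average (fun n => by positivity) hHtop
      ((tendsto_add_atTop_iff_nat 1).2 hw.tendsto)
  have h2 : Tendsto (fun n => (∑ i ∈ Finset.range n, θ (i + 1) / ((i : ℝ) + 1) *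
      (mass θ (n - (i + 1)) / mass θ n - 1)) / H n) atTop (𝓝 0) := by
    rw [Metric.tendsto_atTop']
    intro ε hε
    obtain ⟨δ, hδ, hev⟩ := hw.exists_abs_mass_sub_div_le (ε := ε / (2 * C)) (by positivity)
    have hK := hHtop.eventually_gt_atTop (2 / ε * (C / δ * (2 / ϑ + 1)))
    obtain ⟨N, hN⟩ := eventually_atTop.1 (hev.and (hK.and (hw.eventually_le_mass.and
      (hw.eventually_mass_pos.and (eventually_gt_atTop 0)))))
    refine ⟨N, fun n hn => ?_⟩
    obtain ⟨h3, h4, h5, h6, h7⟩ := hN n hn.le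
    have hn' : (0 : ℝ) < n := by exact_mod_cast h7
    have hHpos : 0 < H n := lt_trans (by positivity) h4
    rw [Real.dist_0_eq_abs, abs_div, abs_of_pos hHpos, div_lt_iff₀ hHpos]
    have hterm : ∀ i ∈ Finset.range n, |θ (i + 1) / ((i : ℝ) + 1) *
        (mass θ (n - (i + 1)) / mass θ n - 1)| ≤ ε / 2 * (1 / ((i : ℝ) + 1)) +
          C / (δ * n) * (mass θ (n - (i + 1)) / mass θ n + 1) := by
      intro i _
      have hi : (0 : ℝ) < (i : ℝ) + 1 := by positivity
      have hr : 0 ≤ mass θ (n - (i + 1)) / mass θ n := div_nonneg (hw.mass_nonneg _) h6.le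
      rw [abs_mul, abs_of_nonneg (div_nonneg (hw.nonneg _) hi.le)]
      -- Either the ratio of the masses is close to one, or `1 / (i + 1)` is at most `1 / (δ n)`.
      by_cases hcase : ((i + 1 : ℕ) : ℝ) ≤ δ * n
      · refine le_add_of_le_of_nonneg ?_ (by positivity)
        calc θ (i + 1) / ((i : ℝ) + 1) * |mass θ (n - (i + 1)) / mass θ n - 1|
            ≤ C / ((i : ℝ) + 1) * (ε / (2 * C)) :=
              mul_le_mul (div_le_div_of_nonneg_right (hC _) hi.le) (h3 _ hcase) (abs_nonneg _)
                (by positivity)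
          _ = _ := by field_simp
      · refine le_add_of_nonneg_of_le (by positivity) ?_
        push_cast at hcase
        refine mul_le_mul ?_ ?_ (abs_nonneg _) (by positivity)
        · exact div_le_div₀ hC0.le (hC _) (by positivity) (not_le.1 hcase).le
        · rw [abs_le]
          constructor <;> linarith
    have hsum : ∑ i ∈ Finset.range n, mass θ (n - (i + 1)) = cumMass θ n := by
      rw [cumMass, ← Finset.sum_range_reflect]
      refine Finset.sum_congr rfl fun i hi => ?_
      rw [Finset.mem_range] at hi
      congr 1
      omega
    have hratio : cumMass θ n / mass θ n ≤ 2 / ϑ * n := by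
      rw [div_le_iff₀ h6, div_mul_eq_mul_div, div_mul_eq_mul_div, le_div_iff₀ hϑ]
      linarith
    calc |∑ i ∈ Finset.range n, θ (i + 1) / ((i : ℝ) + 1) *
          (mass θ (n - (i + 1)) / mass θ n - 1)|
        ≤ ∑ i ∈ Finset.range n, (ε / 2 * (1 / ((i : ℝ) + 1)) +
          C / (δ * n) * (mass θ (n - (i + 1)) / mass θ n + 1)) :=
          (Finset.abs_sum_le_sum_abs _ _).trans (Finset.sum_le_sum hterm)
      _ = ε / 2 * H n + C / (δ * n) * (cumMass θ n / mass θ n + n) := by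
          rw [Finset.sum_add_distrib, ← Finset.mul_sum, ← Finset.mul_sum, Finset.sum_add_distrib,
            ← Finset.sum_div, hsum]
          simp [hH]
      _ ≤ ε / 2 * H n + C / (δ * n) * (2 / ϑ * n + n) := by gcongr
      _ = ε / 2 * H n + C / δ * (2 / ϑ + 1) := by field_simp
      _ < ε / 2 * H n + ε / 2 * H n := by
          refine add_lt_add_right ?_ _
          have := mul_lt_mul_of_pos_left h4 (half_pos hε)
          calc C / δ * (2 / ϑ + 1) = ε / 2 * (2 / ε * (C / δ * (2 / ϑ + 1))) := by field_simp
            _ < _ := this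
      _ = ε * H n := by ring
  have h3 := (h1.add h2).mul tendsto_harmonic_div_log
  rw [add_zero, mul_one] at h3
  refine h3.congr' ?_
  filter_upwards [hHtop.eventually_gt_atTop 0] with n hn
  rw [← add_div, ← Finset.sum_add_distrib, div_mul_div_cancel₀ hn.ne']
  congr 1
  exact Finset.sum_congr rfl fun i _ => by ring

theorem update_zero (hw : ConvergentWeights θ ϑ) (k : ℕ) :
    ConvergentWeights (Function.update θ k 0) ϑ where
  nonneg j := by
    rcases eq_or_ne j k with rfl | hj
    · simp
    · rw [Function.update_of_ne hj]
      exact hw.nonneg j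
  pos := hw.pos
  tendsto := by
    refine hw.tendsto.congr' ?_
    filter_upwards [eventually_gt_atTop k] with j hj
    rw [Function.update_of_ne hj.ne']

theorem zeroOn (hw : ConvergentWeights θ ϑ) (s : Finset ℕ) :
    ConvergentWeights (zeroOn s θ) ϑ where
  nonneg j := by
    unfold WeightedPerm.zeroOn
    split_ifs
    · exact le_rfl
    · exact hw.nonneg j
  pos := hw.pos
  tendsto := by
    refine hw.tendsto.congr' ?_
    filter_upwards [eventually_gt_atTop (s.sup id)] with j hj
    rw [WeightedPerm.zeroOn, if_neg]
    intro hjs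
    exact absurd (Finset.le_sup (f := id) hjs) (not_le.2 hj)

/-- Forbidding the cycle length `k` changes the mass asymptotically by the factor `exp (-θ k / k)`.
-/
theorem tendsto_mass_div_mass_update (hw : ConvergentWeights θ ϑ) {k : ℕ} (hk : 0 < k) :
    Tendsto (fun n => mass θ n / mass (Function.update θ k 0) n) atTop
      (𝓝 (Real.exp (θ k / k))) := by
  have hw' := hw.update_zero k
  set θ' := Function.update θ k 0 with hθ'
  obtain ⟨C, hC0, hC⟩ := hw'.exists_mass_sub_le
  have hlam : 0 ≤ θ k / k := div_nonneg (hw.nonneg k) k.cast_nonneg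
  have h := tendsto_tsum_of_dominated_convergence (𝓕 := atTop)
    (f := fun (n r : ℕ) => (θ k / k) ^ r / r.factorial *
      ((if k * r ≤ n then mass θ' (n - k * r) else 0) / mass θ' n))
    (g := fun r : ℕ => (θ k / k) ^ r / r.factorial)
    (bound := fun r : ℕ => C * (k + 1) * ((2 * (θ k / k)) ^ r / r.factorial))
    ((Real.summable_pow_div_factorial _).mul_left _) ?_ ?_
  · rw [← congrFun NormedSpace.exp_eq_tsum_div, ← Real.exp_eq_exp_ℝ] at h
    refine h.congr fun n => ?_
    rw [mass_eq_tsum θ hk n, ← tsum_div_const]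
    simp only [mul_div_assoc]
    rfl
  · intro r
    have h1 : Tendsto (fun n => (if k * r ≤ n then mass θ' (n - k * r) else 0) / mass θ' n) atTop
        (𝓝 1) := by
      rw [← tendsto_add_atTop_iff_nat (k * r)]
      refine (hw'.tendsto_mass_div_mass_add (k * r)).congr fun n => ?_
      rw [if_pos (Nat.le_add_left _ _), Nat.add_sub_cancel]
    simpa using h1.const_mul ((θ k / k) ^ r / r.factorial)
  · filter_upwards [hC, hw'.eventually_mass_pos] with n hn hm r
    -- The linear growth in `k * r` of the ratio of masses is absorbed into `2 ^ r`.
    have h1 : (if k * r ≤ n then mass θ' (n - k * r) else 0) / mass θ' n ≤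
        C * (k + 1) * 2 ^ r := by
      rw [div_le_iff₀ hm]
      split_ifs with hr
      · refine (hn _ hr).trans (mul_le_mul_of_nonneg_right ?_ hm.le)
        rw [mul_assoc]
        refine mul_le_mul_of_nonneg_left ?_ hC0.le
        have h2 : (r : ℝ) + 1 ≤ 2 ^ r := by exact_mod_cast Nat.lt_two_pow_self
        have h3 : (0 : ℝ) ≤ r := r.cast_nonneg
        have h4 : (0 : ℝ) ≤ k := k.cast_nonneg
        push_cast
        nlinarith
      · positivity
    have h2 : 0 ≤ (if k * r ≤ n then mass θ' (n - k * r) else 0) / mass θ' n := by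
      refine div_nonneg ?_ hm.le
      split_ifs
      · exact hw'.mass_nonneg _
      · exact le_rfl
    rw [Real.norm_of_nonneg (mul_nonneg (by positivity) h2)]
    calc _ ≤ (θ k / k) ^ r / r.factorial * (C * (k + 1) * 2 ^ r) := by gcongr
      _ = _ := by rw [mul_pow]; ring

theorem tendsto_mass_zeroOn_div (hw : ConvergentWeights θ ϑ) (s : Finset ℕ)
    (hs : ∀ k ∈ s, 0 < k) :
    Tendsto (fun n => mass (WeightedPerm.zeroOn s θ) n / mass θ n) atTop
      (𝓝 (∏ k ∈ s, Real.exp (-(θ k / k)))) := by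
  induction s using Finset.induction_on with
  | empty =>
    have h0 : WeightedPerm.zeroOn ∅ θ = θ := by ext; simp [WeightedPerm.zeroOn]
    rw [h0, Finset.prod_empty]
    refine tendsto_const_nhds.congr' ?_
    filter_upwards [hw.eventually_mass_pos] with n hn
    exact (div_self hn.ne').symm
  | insert k s hk ih =>
    have h1 : Function.update (WeightedPerm.zeroOn s θ) k 0 =
        WeightedPerm.zeroOn (insert k s) θ := by
      ext j
      by_cases hj : j = k
      · subst hj; simp [WeightedPerm.zeroOn]
      · simp [WeightedPerm.zeroOn, hj]
    have h2 : WeightedPerm.zeroOn s θ k = θ k := by simp [WeightedPerm.zeroOn, hk]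
    have h3 := (hw.zeroOn s).tendsto_mass_div_mass_update (hs k (Finset.mem_insert_self _ _))
    rw [h1, h2] at h3
    have h4 := (h3.inv₀ (Real.exp_ne_zero _)).mul
      (ih fun j hj => hs j (Finset.mem_insert_of_mem hj))
    rw [Finset.prod_insert hk, Real.exp_neg]
    refine h4.congr' ?_
    filter_upwards [(hw.zeroOn s).eventually_mass_pos] with n hn
    rw [inv_div, div_mul_div_cancel₀ hn.ne']

/-- The numbers of cycles with lengths in a finite set are asymptotically independent and Poisson
distributed. -/
theorem tendsto_weightedMean_counts (hw : ConvergentWeights θ ϑ) (s : Finset ℕ)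
    (hs : ∀ k ∈ s, 0 < k) (r : ℕ → ℕ) :
    Tendsto (fun n => weightedMean θ n (fun l => ∏ k ∈ s, if l.count k = r k then 1 else 0) /
      mass θ n) atTop
      (𝓝 (∏ k ∈ s, (Real.exp (-(θ k / k)) * (θ k / k) ^ r k / (r k).factorial))) := by
  rw [← tendsto_add_atTop_iff_nat (∑ k ∈ s, k * r k)]
  simp only [weightedMean_counts_eq θ s hs]
  have h := ((hw.tendsto_mass_zeroOn_div s hs).mul
    (hw.tendsto_mass_div_mass_add (∑ k ∈ s, k * r k))).const_mul
      (∏ k ∈ s, (θ k / k) ^ r k / (r k).factorial)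
  rw [mul_one, ← Finset.prod_mul_distrib] at h
  have hval : ∀ k, Real.exp (-(θ k / k)) * (θ k / k) ^ r k / (r k).factorial =
      (θ k / k) ^ r k / (r k).factorial * Real.exp (-(θ k / k)) := fun k => by ring
  simp only [hval, mul_div_assoc] at h ⊢
  refine h.congr' ?_
  filter_upwards [hw.eventually_mass_pos] with n hn
  rw [div_mul_div_cancel₀ hn.ne']

end ConvergentWeights

/-! ### Weak convergence of the cycle counts and the mean number of cycles -/

theorem isProbabilityMeasure_P {θ : ℕ → ℝ≥0} {n : ℕ} (hn : 0 < h θ n) :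
    IsProbabilityMeasure (P θ n : Measure (Equiv.Perm (Fin n))) := by
  have h1 := integral_P_eq_weightedMean θ n fun _ => 1
  have h2 : (h θ n : ℝ) ≠ 0 := by exact_mod_cast hn.ne'
  rw [← mass, div_self (by rwa [← coe_h_eq_mass])] at h1
  refine ⟨?_⟩
  rw [integral_const, smul_eq_mul, mul_one, measureReal_def, ENNReal.toReal_eq_one_iff] at h1
  exact h1

theorem integral_map_P {E : Type*} [MeasurableSpace E] (θ : ℕ → ℝ≥0) (n : ℕ)
    (g : Equiv.Perm (Fin n) → E) {f : E → ℝ} (hf : StronglyMeasurable f) :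
    ∫ x, f x ∂((P θ n).map g : Measure E) =
      ∫ σ, f (g σ) ∂(P θ n : Measure (Equiv.Perm (Fin n))) :=
  integral_map measurable_from_top.aemeasurable hf.aestronglyMeasurable

/-- The convergence criterion of a π-system, for finite measures that are eventually probability
measures. -/
theorem tendsto_toFiniteMeasure_of_piSystem {Ω : Type*} [MeasurableSpace Ω] [TopologicalSpace Ω]
    [SecondCountableTopology Ω] [OpensMeasurableSpace Ω] {S : Set (Set Ω)} (hS : IsPiSystem S)
    {μ : ℕ → FiniteMeasure Ω} {ν : ProbabilityMeasure Ω}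
    (hμ : ∀ᶠ n in atTop, IsProbabilityMeasure (μ n : Measure Ω))
    (hmeas : ∀ s ∈ S, MeasurableSet s)
    (hnhds : ∀ u : Set Ω, IsOpen u → ∀ x ∈ u, ∃ s ∈ S, s ∈ 𝓝 x ∧ s ⊆ u)
    (hlim : ∀ s ∈ S, Tendsto (fun n => (μ n : Measure Ω).real s) atTop
      (𝓝 ((ν : Measure Ω).real s))) :
    Tendsto μ atTop (𝓝 ν.toFiniteMeasure) := by
  classical
  set μ' : ℕ → ProbabilityMeasure Ω := fun n =>
    if hn : IsProbabilityMeasure (μ n : Measure Ω) then ⟨μ n, hn⟩ else ν with hμ'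
  have heq : ∀ᶠ n in atTop, (μ' n).toFiniteMeasure = μ n := by
    filter_upwards [hμ] with n hn
    exact (congrArg ProbabilityMeasure.toFiniteMeasure (dif_pos hn)).trans rfl
  have h1 : Tendsto μ' atTop (𝓝 ν) := by
    refine hS.tendsto_probabilityMeasure_of_tendsto_of_mem hmeas hnhds fun s hs => ?_
    rw [← NNReal.tendsto_coe]
    refine (hlim s hs).congr' ?_
    filter_upwards [heq] with n hn
    rw [← hn]
    rfl
  exact ((ProbabilityMeasure.tendsto_nhds_iff_toFiniteMeasure_tendsto_nhds _).1 h1).congr' heq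

/-- The cylinder of all sequences whose first `m` entries are those of `r`. -/
def initialCylinder (m : ℕ) (r : ℕ → ℕ) : Set (ℕ → ℕ) :=
  Set.pi (Finset.range m) fun i => {r i}

theorem mem_initialCylinder {m : ℕ} {r x : ℕ → ℕ} :
    x ∈ initialCylinder m r ↔ ∀ i < m, x i = r i := by
  simp [initialCylinder]

theorem isOpen_initialCylinder (m : ℕ) (r : ℕ → ℕ) : IsOpen (initialCylinder m r) :=
  isOpen_set_pi (Finset.finite_toSet _) fun _ _ => isOpen_discrete _

theorem isPiSystem_initialCylinder :
    IsPiSystem {s | ∃ m r, s = initialCylinder m r} := by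
  rintro _ ⟨m₁, r₁, rfl⟩ _ ⟨m₂, r₂, rfl⟩ ⟨x, hx₁, hx₂⟩
  rw [mem_initialCylinder] at hx₁ hx₂
  refine ⟨max m₁ m₂, x, ?_⟩
  ext y
  simp only [Set.mem_inter_iff, mem_initialCylinder]
  constructor
  · rintro ⟨h₁, h₂⟩ i hi
    rcases lt_max_iff.1 hi with hi | hi
    · rw [h₁ i hi, hx₁ i hi]
    · rw [h₂ i hi, hx₂ i hi]
  · intro hy
    exact ⟨fun i hi => (hy i (lt_max_of_lt_left hi)).trans (hx₁ i hi),
      fun i hi => (hy i (lt_max_of_lt_right hi)).trans (hx₂ i hi)⟩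

theorem exists_initialCylinder_subset {u : Set (ℕ → ℕ)} (hu : IsOpen u) {x : ℕ → ℕ} (hx : x ∈ u) :
    ∃ m, initialCylinder m x ⊆ u := by
  obtain ⟨I, v, hv, hsub⟩ := isOpen_pi_iff.1 hu x hx
  refine ⟨I.sup id + 1, fun y hy => hsub fun i hi => ?_⟩
  rw [mem_initialCylinder.1 hy i (Nat.lt_succ_of_le (Finset.le_sup (f := id) hi))]
  exact (hv i hi).2

theorem poissonLaw_initialCylinder (θ : ℕ → ℝ≥0) (m : ℕ) (r : ℕ → ℕ) :
    (poissonLaw θ : Measure (ℕ → ℕ)).real (initialCylinder m r) =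
      ∏ i ∈ Finset.range m, (Real.exp (-(θ (i + 1) / (i + 1 : ℕ))) *
        (θ (i + 1) / (i + 1 : ℕ) : ℝ) ^ r i / (r i).factorial) := by
  change (Measure.infinitePi fun i : ℕ => poissonMeasure (θ (i + 1) / (i + 1))).real _ = _
  rw [initialCylinder, measureReal_def, Measure.infinitePi_pi _ fun _ _ => MeasurableSet.of_discrete,
    ENNReal.toReal_prod]
  refine Finset.prod_congr rfl fun i _ => ?_
  rw [← measureReal_def, poissonMeasure_real_singleton]
  push_cast
  rfl

theorem ConvergentWeights.of_nnreal {θ : ℕ → ℝ≥0} {θlim : ℝ} (hpos : 0 < θlim)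
    (hlim : Tendsto (fun j => (θ j : ℝ)) atTop (𝓝 θlim)) :
    ConvergentWeights (fun j => (θ j : ℝ)) θlim :=
  ⟨fun j => (θ j).2, hpos, hlim⟩

theorem eventually_h_pos {θ : ℕ → ℝ≥0} {θlim : ℝ}
    (hw : ConvergentWeights (fun j => (θ j : ℝ)) θlim) : ∀ᶠ n in atTop, 0 < h θ n := by
  filter_upwards [hw.eventually_mass_pos] with n hn
  rw [← coe_h_eq_mass] at hn
  exact_mod_cast hn

theorem tendsto_cycleCounts {θ : ℕ → ℝ≥0} {θlim : ℝ}
    (hw : ConvergentWeights (fun j => (θ j : ℝ)) θlim) :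
    Tendsto (fun n => (P θ n).map cycleCounts) atTop (𝓝 (poissonLaw θ).toFiniteMeasure) := by
  refine tendsto_toFiniteMeasure_of_piSystem isPiSystem_initialCylinder ?_ ?_ ?_ ?_
  · filter_upwards [eventually_h_pos hw] with n hn
    have := isProbabilityMeasure_P hn
    exact Measure.isProbabilityMeasure_map measurable_from_top.aemeasurable
  · rintro _ ⟨m, r, rfl⟩
    exact (isOpen_initialCylinder m r).measurableSet
  · intro u hu x hx
    obtain ⟨m, hm⟩ := exists_initialCylinder_subset hu hx
    exact ⟨_, ⟨m, x, rfl⟩, (isOpen_initialCylinder m x).mem_nhds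
      (mem_initialCylinder.2 fun _ _ => rfl), hm⟩
  · rintro _ ⟨m, r, rfl⟩
    set s : Finset ℕ := (Finset.range m).image (· + 1) with hs
    have hinj : Set.InjOn (· + 1) (Finset.range m : Set ℕ) := fun _ _ _ _ hab =>
      Nat.succ_injective hab
    have h1 := hw.tendsto_weightedMean_counts s (by
      intro k hk
      obtain ⟨i, _, rfl⟩ := Finset.mem_image.1 hk
      exact i.succ_pos) fun k => r (k - 1)
    rw [hs, Finset.prod_image hinj] at h1
    simp only [Nat.add_sub_cancel] at h1
    rw [poissonLaw_initialCylinder]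
    refine h1.congr fun n => ?_
    have hmeas := (isOpen_initialCylinder m r).measurableSet
    rw [← integral_indicator_one hmeas, integral_map_P _ _ _
      (stronglyMeasurable_one.indicator hmeas), ← integral_P_eq_weightedMean]
    congr 1
    ext σ
    rw [Finset.prod_image hinj]
    by_cases hσ : cycleCounts σ ∈ initialCylinder m r
    · rw [Set.indicator_of_mem hσ]
      refine Finset.prod_eq_one fun i hi => ?_
      rw [if_pos]
      rw [← R_eq_count]
      exact mem_initialCylinder.1 hσ i (Finset.mem_range.1 hi)
    · rw [Set.indicator_of_notMem hσ]
      rw [mem_initialCylinder] at hσ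
      push Not at hσ
      obtain ⟨i, hi, hne⟩ := hσ
      refine Finset.prod_eq_zero (Finset.mem_range.2 hi) (if_neg ?_)
      rw [← R_eq_count]
      exact hne

theorem tendsto_mean_K {θ : ℕ → ℝ≥0} {θlim : ℝ}
    (hw : ConvergentWeights (fun j => (θ j : ℝ)) θlim) :
    Tendsto (fun n : ℕ =>
      (∫ σ, (K σ : ℝ) ∂(P θ n : Measure (Equiv.Perm (Fin n)))) / Real.log n) atTop (𝓝 θlim) := by
  refine hw.tendsto_mean_cycles_div_log.congr fun n => ?_
  have h1 : ∀ σ : Equiv.Perm (Fin n), (K σ : ℝ) =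
      (fun l : List ℕ => ∑ i ∈ Finset.range n, (l.count (i + 1) : ℝ)) (ageLengths σ) := by
    intro σ
    have hIcc : Finset.Icc 1 n = Finset.Ico (0 + 1) (n + 1) := by ext; simp
    rw [K, hIcc, ← Finset.sum_Ico_add' (fun j => R j σ), ← Finset.range_eq_Ico]
    simp [R_eq_count]
  have h2 := (integral_congr_ae (μ := (P θ n : Measure (Equiv.Perm (Fin n))))
    (Eventually.of_forall h1)).trans (integral_P_eq_weightedMean θ n
      fun l => ∑ i ∈ Finset.range n, (l.count (i + 1) : ℝ))
  rw [h2, weightedMean_sum]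
  congr 1
  rw [Finset.sum_div]
  refine Finset.sum_congr rfl fun i hi => ?_
  rw [Finset.mem_range] at hi
  obtain ⟨m, rfl⟩ := Nat.exists_eq_add_of_le' (Nat.succ_le_of_lt hi)
  rw [weightedMean_count _ i.succ_pos, Nat.add_sub_cancel]
  push_cast
  ring

/-! ### Weak convergence from moments -/

/-- The method of moments: measures on the cube `[0, 1]^ℕ` converge weakly if the integrals of all
products of members of a family of continuous functions that separates points do. -/
theorem tendsto_of_tendsto_integral_prod {μ : ℕ → FiniteMeasure (ℕ → ℝ)}
    {ν : FiniteMeasure (ℕ → ℝ)} (φ : ℕ → C(ℕ → ℝ, ℝ))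
    (hφ : ∀ x y : ℕ → ℝ, (∀ i, φ i x = φ i y) → x = y)
    (hμ : ∀ n, ∀ᵐ x ∂(μ n : Measure (ℕ → ℝ)), ∀ i, x i ∈ Set.Icc (0 : ℝ) 1)
    (hν : ∀ᵐ x ∂(ν : Measure (ℕ → ℝ)), ∀ i, x i ∈ Set.Icc (0 : ℝ) 1)
    (hlim : ∀ L : List ℕ, Tendsto (fun n => ∫ x, (L.map fun i => φ i x).prod ∂(μ n : Measure _))
      atTop (𝓝 (∫ x, (L.map fun i => φ i x).prod ∂(ν : Measure (ℕ → ℝ))))) :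
    Tendsto μ atTop (𝓝 ν) := by
  set Q : Set (ℕ → ℝ) := Set.pi Set.univ fun _ => Set.Icc (0 : ℝ) 1 with hQ
  have hQc : IsCompact Q := isCompact_univ_pi fun _ => isCompact_Icc
  have hmem : ∀ ρ : FiniteMeasure (ℕ → ℝ),
      (∀ᵐ x ∂(ρ : Measure (ℕ → ℝ)), ∀ i, x i ∈ Set.Icc (0 : ℝ) 1) →
      ∀ᵐ x ∂(ρ : Measure (ℕ → ℝ)), x ∈ Q := by
    intro ρ hρ
    filter_upwards [hρ] with x hx i _ using hx i
  have hint : ∀ ρ : FiniteMeasure (ℕ → ℝ),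
      (∀ᵐ x ∂(ρ : Measure (ℕ → ℝ)), ∀ i, x i ∈ Set.Icc (0 : ℝ) 1) →
      ∀ g : C(ℕ → ℝ, ℝ), Integrable g (ρ : Measure (ℕ → ℝ)) := by
    intro ρ hρ g
    obtain ⟨M, hM⟩ := hQc.exists_bound_of_continuousOn g.continuous.continuousOn
    refine Integrable.of_bound g.continuous.aestronglyMeasurable M ?_
    filter_upwards [hmem ρ hρ] with x hx using hM x hx
  set A : Subalgebra ℝ C(ℕ → ℝ, ℝ) := Algebra.adjoin ℝ (Set.range φ) with hA
  have hAsep : A.SeparatesPoints := by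
    intro x y hxy
    obtain ⟨i, hi⟩ : ∃ i, φ i x ≠ φ i y := by
      by_contra! hcon
      exact hxy (hφ x y hcon)
    exact ⟨φ i, ⟨φ i, Algebra.subset_adjoin ⟨i, rfl⟩, rfl⟩, hi⟩
  have hAlim : ∀ g ∈ A, Tendsto (fun n => ∫ x, g x ∂(μ n : Measure _)) atTop
      (𝓝 (∫ x, g x ∂(ν : Measure (ℕ → ℝ)))) := by
    intro g hg
    rw [hA, ← Subalgebra.mem_toSubmodule, Algebra.adjoin_eq_span] at hg
    induction hg using Submodule.span_induction with
    | mem g hg =>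
      obtain ⟨L, hL, rfl⟩ := Submonoid.exists_list_of_mem_closure hg
      obtain ⟨L', rfl⟩ : ∃ L' : List ℕ, L'.map φ = L := by
        have : L ∈ Set.range (List.map φ) := by
          rw [Set.range_list_map]
          exact hL
        exact this
      have hprod : ∀ x, (L'.map φ).prod x = (L'.map fun i => φ i x).prod := by
        intro x
        induction L' with
        | nil => rfl
        | cons a L' ih =>
          rw [List.map_cons, List.map_cons, List.prod_cons, List.prod_cons, ContinuousMap.mul_apply,
            ih (fun y hy => hL y (List.mem_cons_of_mem _ hy))
              (Submonoid.list_prod_mem _ fun y hy =>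
                Submonoid.subset_closure (hL y (List.mem_cons_of_mem _ hy)))]
      simp only [hprod]
      exact hlim L'
    | zero => simp
    | add g₁ g₂ _ _ h₁ h₂ =>
      have := h₁.add h₂
      refine (this.congr fun n => ?_).trans_eq ?_
      · exact (integral_add (hint _ (hμ n) g₁) (hint _ (hμ n) g₂)).symm
      · rw [← integral_add (hint _ hν g₁) (hint _ hν g₂)]
        rfl
    | smul c g _ h =>
      have := h.const_mul c
      simpa [integral_const_mul] using this
  rw [FiniteMeasure.tendsto_iff_forall_integral_tendsto]
  intro f
  have hmass : Tendsto (fun n => (μ n : Measure (ℕ → ℝ)).real Set.univ) atTop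
      (𝓝 ((ν : Measure (ℕ → ℝ)).real Set.univ)) := by
    simpa using hlim []
  set M := (ν : Measure (ℕ → ℝ)).real Set.univ + 1 with hM
  have hMpos : 0 < M := by positivity
  rw [Metric.tendsto_atTop']
  intro ε hε
  obtain ⟨g, hgA, hg⟩ :=
    ContinuousMap.exists_mem_subalgebra_near_continuous_of_isCompact_of_separatesPoints hAsep
      f.toContinuousMap hQc (ε := ε / (3 * M)) (by positivity)
  -- Replacing `f` by the polynomial `g` costs at most `ε / 3` in each integral.
  have hclose : ∀ ρ : FiniteMeasure (ℕ → ℝ),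
      (∀ᵐ x ∂(ρ : Measure (ℕ → ℝ)), ∀ i, x i ∈ Set.Icc (0 : ℝ) 1) →
      (ρ : Measure (ℕ → ℝ)).real Set.univ ≤ M →
      |∫ x, g x ∂(ρ : Measure (ℕ → ℝ)) - ∫ x, f x ∂(ρ : Measure (ℕ → ℝ))| ≤ ε / 3 := by
    intro ρ hρ hρM
    have hf : Integrable f (ρ : Measure (ℕ → ℝ)) := hint ρ hρ f.toContinuousMap
    rw [← integral_sub (hint ρ hρ g) hf]
    refine (norm_integral_le_of_norm_le_const (μ := (ρ : Measure (ℕ → ℝ)))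
      (f := fun x => g x - f x) (C := ε / (3 * M)) ?_).trans ?_
    · filter_upwards [hmem ρ hρ] with x hx using (hg x hx).le
    · calc ε / (3 * M) * (ρ : Measure (ℕ → ℝ)).real Set.univ ≤ ε / (3 * M) * M := by gcongr
        _ = ε / 3 := by field_simp
  obtain ⟨N, hN⟩ := eventually_atTop.1 ((hmass.eventually (gt_mem_nhds (lt_add_one _))).and
    ((hAlim g hgA).eventually (Metric.ball_mem_nhds _ (by positivity : 0 < ε / 3))))
  refine ⟨N, fun n hn => ?_⟩
  obtain ⟨h1, h2⟩ := hN n hn.le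
  have h3 := hclose (μ n) (hμ n) h1.le
  have h4 := hclose ν hν (lt_add_one _).le
  rw [Real.dist_eq] at h2 ⊢
  rw [abs_le] at h3 h4
  rw [abs_lt] at h2 ⊢
  constructor <;> linarith

/-! ### Stick breaking and residuals -/

/-- What is left of a stick of length one after the first `i` pieces have been removed. -/
noncomputable def residual (i : ℕ) : C(ℕ → ℝ, ℝ) where
  toFun x := 1 - ∑ j ∈ Finset.range i, x j
  continuous_toFun := by fun_prop

theorem residual_apply (i : ℕ) (x : ℕ → ℝ) : residual i x = 1 - ∑ j ∈ Finset.range i, x j := rfl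

theorem eq_residual_sub (x : ℕ → ℝ) (i : ℕ) : x i = residual i x - residual (i + 1) x := by
  rw [residual_apply, residual_apply, Finset.sum_range_succ]
  ring

theorem residual_stickBreaking (x : ℕ → ℝ) (i : ℕ) :
    residual i (stickBreaking x) = ∏ j ∈ Finset.range i, (1 - x j) := by
  induction i with
  | zero => simp [residual_apply]
  | succ i ih =>
    have h := eq_residual_sub (stickBreaking x) i
    rw [ih] at h
    rw [Finset.prod_range_succ]
    have h2 : stickBreaking x i = (∏ j ∈ Finset.range i, (1 - x j)) * x i := rfl
    linarith

/-- The total exponent of all residuals with index larger than `j` and smaller than `k`, that is,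
the exponent of `1 - x j` in the product of these powers. -/
def tailExponent (k : ℕ) (b : ℕ → ℕ) (j : ℕ) : ℕ :=
  ∑ i ∈ Finset.range k, if j < i then b i else 0

/-- The moment `E ∏_{i < k} y_i ^ b_i` of the residuals `y_i` under the GEM distribution. -/
noncomputable def gemMoment (ϑ : ℝ) (k : ℕ) (b : ℕ → ℕ) : ℝ :=
  ∏ j ∈ Finset.range k, ϑ / (ϑ + tailExponent k b j)

theorem tailExponent_succ_zero (k : ℕ) (b : ℕ → ℕ) :
    tailExponent (k + 1) b 0 = ∑ i ∈ Finset.range k, b (i + 1) := by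
  simp [tailExponent, Finset.sum_range_succ']

theorem tailExponent_succ_succ (k : ℕ) (b : ℕ → ℕ) (j : ℕ) :
    tailExponent (k + 1) b (j + 1) = tailExponent k (fun i => b (i + 1)) j := by
  simp [tailExponent, Finset.sum_range_succ']

theorem gemMoment_succ (ϑ : ℝ) (k : ℕ) (b : ℕ → ℕ) :
    gemMoment ϑ (k + 1) b = gemMoment ϑ k (fun i => b (i + 1)) *
      (ϑ / (ϑ + (∑ i ∈ Finset.range k, b (i + 1) : ℕ))) := by
  simp only [gemMoment]
  rw [Finset.prod_range_succ', tailExponent_succ_zero]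
  simp only [tailExponent_succ_succ]

theorem prod_pow_partial_prod (z : ℕ → ℝ) (k : ℕ) (b : ℕ → ℕ) :
    ∏ i ∈ Finset.range k, (∏ j ∈ Finset.range i, z j) ^ b i =
      ∏ j ∈ Finset.range k, z j ^ tailExponent k b j := by
  have h1 : ∀ i ∈ Finset.range k, (∏ j ∈ Finset.range i, z j) ^ b i =
      ∏ j ∈ Finset.range k, z j ^ (if j < i then b i else 0) := by
    intro i hi
    rw [Finset.mem_range] at hi
    rw [← Finset.prod_pow]
    refine Finset.prod_subset_one_on_sdiff (Finset.range_mono hi.le) ?_ ?_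
    · intro j hj
      rw [Finset.mem_sdiff, Finset.mem_range, Finset.mem_range] at hj
      rw [if_neg hj.2, pow_zero]
    · intro j hj
      rw [if_pos (Finset.mem_range.1 hj)]
  rw [Finset.prod_congr rfl h1, Finset.prod_comm]
  exact Finset.prod_congr rfl fun j _ => Finset.prod_pow_eq_pow_sum _ _ _

/-! ### Moments of the age-ordered cycle lengths -/

/-- The product of the powers `r_i ^ b_i`, `i < k`, where `r_i` is what is left of `n` after the
first `i` entries of the list have been subtracted. -/
noncomputable def restProd (k : ℕ) (b : ℕ → ℕ) (n : ℕ) (l : List ℕ) : ℝ :=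
  ∏ i ∈ Finset.range k, ((n : ℝ) - (l.take i).sum) ^ b i

theorem restProd_succ (k : ℕ) (b : ℕ → ℕ) (j m : ℕ) (l : List ℕ) :
    restProd (k + 1) b (j + m) (j :: l) =
      ((j + m : ℕ) : ℝ) ^ b 0 * restProd k (fun i => b (i + 1)) m l := by
  simp only [restProd]
  rw [Finset.prod_range_succ', mul_comm]
  congr 1
  · simp
  · refine Finset.prod_congr rfl fun i _ => ?_
    rw [List.take_succ_cons, List.sum_cons]
    push_cast
    congr 1
    ring

theorem restProd_mem (k : ℕ) (b : ℕ → ℕ) {n : ℕ} {l : List ℕ} (hl : l.sum = n) :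
    0 ≤ restProd k b n l ∧ restProd k b n l ≤ (n : ℝ) ^ ∑ i ∈ Finset.range k, b i := by
  have h1 : ∀ i, 0 ≤ (n : ℝ) - (l.take i).sum := by
    intro i
    have : (l.take i).sum ≤ n := hl ▸ (List.take_sublist i l).sum_le_sum fun _ _ => Nat.zero_le _
    have : ((l.take i).sum : ℝ) ≤ n := by exact_mod_cast this
    linarith
  refine ⟨Finset.prod_nonneg fun i _ => pow_nonneg (h1 i) _, ?_⟩
  rw [← Finset.prod_pow_eq_pow_sum]
  refine Finset.prod_le_prod (fun i _ => pow_nonneg (h1 i) _) fun i _ => ?_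
  refine pow_le_pow_left₀ (h1 i) ?_ _
  have : (0 : ℝ) ≤ (l.take i).sum := Nat.cast_nonneg _
  linarith

/-- The moments of the residuals converge to those under the GEM distribution; the induction splits
off the first cycle. -/
theorem ConvergentWeights.tendsto_restProd {θ : ℕ → ℝ} {ϑ : ℝ} (hw : ConvergentWeights θ ϑ)
    (k : ℕ) (b : ℕ → ℕ) :
    Tendsto (fun n : ℕ => weightedMean θ n (restProd k b n) /
      ((n : ℝ) ^ (∑ i ∈ Finset.range k, b i) * mass θ n)) atTop (𝓝 (gemMoment ϑ k b)) := by
  induction k generalizing b with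
  | zero =>
    simp only [gemMoment, Finset.range_zero, Finset.prod_empty, Finset.sum_empty,
      pow_zero, one_mul]
    refine tendsto_const_nhds.congr' ?_
    filter_upwards [hw.eventually_mass_pos] with n hn
    exact (div_self hn.ne').symm
  | succ k ih =>
    have hq : ∀ m : ℕ, weightedMean θ m (restProd k (fun i => b (i + 1)) m) ≤
        (m : ℝ) ^ (∑ i ∈ Finset.range k, b (i + 1)) * mass θ m := fun m => by
      rw [← weightedMean_const]
      exact weightedMean_mono hw.nonneg fun l hl => (restProd_mem k _ hl).2
    have h := hw.tendsto_sum_weights_mul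
      (fun m => weightedMean_nonneg hw.nonneg fun l hl => (restProd_mem k _ hl).1) hq
      (ih fun i => b (i + 1))
    rw [gemMoment_succ, ← tendsto_add_atTop_iff_nat 1, mul_div_assoc']
    refine h.congr fun n => ?_
    have hn : (n : ℝ) + 1 ≠ 0 := by positivity
    have h1 : (n + 1 : ℝ) * weightedMean θ (n + 1) (restProd (k + 1) b (n + 1)) =
        (n + 1 : ℝ) ^ b 0 * ∑ p ∈ antidiagonal n, θ (p.1 + 1) *
          weightedMean θ p.2 (restProd k (fun i => b (i + 1)) p.2) := by
      rw [weightedMean_succ, Finset.mul_sum]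
      refine Finset.sum_congr rfl fun p hp => ?_
      rw [mem_antidiagonal] at hp
      have h2 : ∀ l, restProd (k + 1) b (n + 1) ((p.1 + 1) :: l) =
          (n + 1 : ℝ) ^ b 0 * restProd k (fun i => b (i + 1)) p.2 l := by
        intro l
        have hnp : n + 1 = p.1 + 1 + p.2 := by omega
        rw [hnp, restProd_succ, ← hnp]
        push_cast
        rfl
      simp only [h2]
      rw [weightedMean_const_mul]
      ring
    rw [Finset.sum_range_succ' b, pow_add]
    push_cast
    have h3 : weightedMean θ (n + 1) (restProd (k + 1) b (n + 1)) =
        (n + 1 : ℝ) ^ b 0 * (∑ p ∈ antidiagonal n, θ (p.1 + 1) *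
          weightedMean θ p.2 (restProd k (fun i => b (i + 1)) p.2)) / (n + 1) := by
      rw [← h1]
      field_simp
    rw [h3]
    -- If the mass vanishes, then both quotients are zero by convention.
    rcases eq_or_ne (mass θ (n + 1)) 0 with h0 | h0
    · simp [h0]
    · field_simp

theorem residual_ageOrderedLengths {n : ℕ} (hn : 0 < n) (σ : Equiv.Perm (Fin n)) (i : ℕ) :
    residual i (ageOrderedLengths σ) = ((n : ℝ) - ((ageLengths σ).take i).sum) / n := by
  have hn' : (n : ℝ) ≠ 0 := by positivity
  have h1 : ∀ l : List ℕ, ∑ j ∈ Finset.range i, l.getD j 0 = (l.take i).sum := by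
    induction i with
    | zero => simp
    | succ i ih =>
      intro l
      rw [Finset.sum_range_succ, ih, List.take_add_one, List.sum_append]
      congr 1
      rcases lt_or_ge i l.length with hi | hi
      · simp [List.getElem?_eq_getElem hi]
      · simp [List.getElem?_eq_none hi]
  rw [residual_apply, ageOrderedLengths_eq, ← Finset.sum_div, ← Nat.cast_sum, h1]
  field_simp

theorem prod_map_eq_prod_range (f : ℕ → ℝ) (L : List ℕ) :
    (L.map f).prod = ∏ i ∈ Finset.range (L.sum + 1), f i ^ L.count i := by
  rw [Finset.prod_list_map_count]
  refine Finset.prod_subset ?_ ?_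
  · intro i hi
    rw [List.mem_toFinset] at hi
    exact Finset.mem_range.2 (Nat.lt_succ_of_le (List.single_le_sum (fun _ _ => Nat.zero_le _) i hi))
  · intro i _ hi
    rw [List.mem_toFinset] at hi
    rw [List.count_eq_zero_of_not_mem hi, pow_zero]

theorem tendsto_integral_residual {θ : ℕ → ℝ≥0} {θlim : ℝ}
    (hw : ConvergentWeights (fun j => (θ j : ℝ)) θlim) (k : ℕ) (b : ℕ → ℕ) :
    Tendsto (fun n => ∫ σ : Equiv.Perm (Fin n),
      ∏ i ∈ Finset.range k, residual i (ageOrderedLengths σ) ^ b i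
        ∂(P θ n : Measure (Equiv.Perm (Fin n)))) atTop (𝓝 (gemMoment θlim k b)) := by
  refine (hw.tendsto_restProd k b).congr' ?_
  filter_upwards [eventually_gt_atTop 0] with n hn
  have hn' : (n : ℝ) ≠ 0 := by positivity
  have h1 : ∀ σ : Equiv.Perm (Fin n),
      ∏ i ∈ Finset.range k, residual i (ageOrderedLengths σ) ^ b i =
        ((n : ℝ) ^ ∑ i ∈ Finset.range k, b i)⁻¹ * restProd k b n (ageLengths σ) := by
    intro σ
    simp only [residual_ageOrderedLengths hn, div_pow]
    rw [Finset.prod_div_distrib, Finset.prod_pow_eq_pow_sum, restProd]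
    ring
  rw [integral_congr_ae (Eventually.of_forall h1), integral_const_mul, integral_P_eq_weightedMean]
  rw [div_mul_eq_div_div_swap]
  ring

/-! ### Moments of the GEM distribution -/

theorem measurable_betaPDF (α β : ℝ) : Measurable (betaPDF α β) :=
  (measurable_betaPDFReal α β).ennreal_ofReal

theorem betaMeasure_ae_mem (ϑ : ℝ) : ∀ᵐ x ∂(betaMeasure 1 ϑ), x ∈ Set.Icc (0 : ℝ) 1 := by
  rw [betaMeasure, ae_withDensity_iff (measurable_betaPDF 1 ϑ)]
  refine Eventually.of_forall fun x hx => ?_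
  constructor
  · by_contra! h
    exact hx (betaPDF_eq_zero_of_nonpos h.le)
  · by_contra! h
    exact hx (betaPDF_eq_zero_of_one_le h.le)

theorem beta_one {ϑ : ℝ} (hϑ : 0 < ϑ) : beta 1 ϑ = 1 / ϑ := by
  have h := (Real.Gamma_pos_of_pos hϑ).ne'
  rw [beta, Real.Gamma_one, add_comm 1 ϑ, Real.Gamma_add_one hϑ.ne']
  field_simp

theorem integral_one_sub_pow_betaMeasure {ϑ : ℝ} (hϑ : 0 < ϑ) (B : ℕ) :
    ∫ x, (1 - x) ^ B ∂(betaMeasure 1 ϑ) = ϑ / (ϑ + B) := by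
  have hϑB : 0 < ϑ + B := by positivity
  rw [betaMeasure, integral_withDensity_eq_integral_toReal_smul
    (measurable_betaPDF 1 ϑ) (Eventually.of_forall fun x => ENNReal.ofReal_lt_top)]
  -- Up to a constant, `(1 - x) ^ B` times the density is the beta density with parameter `ϑ + B`.
  have h1 : ∀ x, (betaPDF 1 ϑ x).toReal • (1 - x) ^ B =
      ϑ / (ϑ + B) * (betaPDF 1 (ϑ + B) x).toReal := by
    intro x
    by_cases hx : 0 < x ∧ x < 1
    · have hx1 : 0 < 1 - x := by linarith [hx.2]
      have hx0 := hx.1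
      have hb1 := beta_pos one_pos hϑ
      have hb2 := beta_pos one_pos hϑB
      rw [betaPDF_of_pos_lt_one hx.1 hx.2, betaPDF_of_pos_lt_one hx.1 hx.2,
        ENNReal.toReal_ofReal (by positivity), ENNReal.toReal_ofReal (by positivity), beta_one hϑ,
        beta_one hϑB, add_sub_right_comm, Real.rpow_add_natCast hx1.ne']
      simp only [smul_eq_mul, sub_self, Real.rpow_zero]
      field_simp
    · simp [betaPDF_eq, hx]
  simp only [h1]
  rw [integral_const_mul, integral_toReal
    (measurable_betaPDF 1 (ϑ + B)).aemeasurable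
    (Eventually.of_forall fun x => ENNReal.ofReal_lt_top), lintegral_betaPDF_eq_one one_pos hϑB]
  simp

theorem integral_gem {ϑ : ℝ} (hϑ : 0 < ϑ) {f : (ℕ → ℝ) → ℝ} (hf : StronglyMeasurable f) :
    ∫ x, f x ∂(gem ϑ hϑ : Measure (ℕ → ℝ)) =
      ∫ x, f (stickBreaking x) ∂(Measure.infinitePi fun _ : ℕ => betaMeasure 1 ϑ) :=
  integral_map measurable_stickBreaking.aemeasurable hf.aestronglyMeasurable

theorem integral_residual_gem {ϑ : ℝ} (hϑ : 0 < ϑ) (k : ℕ) (b : ℕ → ℕ) :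
    ∫ x, ∏ i ∈ Finset.range k, residual i x ^ b i ∂(gem ϑ hϑ : Measure (ℕ → ℝ)) =
      gemMoment ϑ k b := by
  have := isProbabilityMeasureBeta one_pos hϑ
  rw [integral_gem hϑ (Continuous.stronglyMeasurable (by fun_prop))]
  simp only [residual_stickBreaking]
  have h1 : ∀ x : ℕ → ℝ, ∏ i ∈ Finset.range k, (∏ j ∈ Finset.range i, (1 - x j)) ^ b i =
      ∏ j : Fin k, (1 - x j) ^ tailExponent k b j := by
    intro x
    rw [prod_pow_partial_prod fun j => 1 - x j,
      Finset.prod_range fun j => (1 - x j) ^ tailExponent k b j]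
  simp only [h1]
  have hind := (iIndepFun_infinitePi (P := fun _ : ℕ => betaMeasure 1 ϑ)
    (X := fun j x => (1 - x) ^ tailExponent k b j) (fun j => by fun_prop)).precomp
      (Fin.val_injective (n := k))
  rw [hind.integral_fun_prod_eq_prod_integral fun j =>
    (((measurable_pi_apply (j : ℕ)).const_sub 1).pow_const _).aestronglyMeasurable]
  rw [gemMoment, Finset.prod_range]
  refine Finset.prod_congr rfl fun j _ => ?_
  rw [← integral_one_sub_pow_betaMeasure hϑ]
  have hmp := measurePreserving_eval_infinitePi (fun _ : ℕ => betaMeasure 1 ϑ) (j : ℕ)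
  have h2 := integral_map (μ := Measure.infinitePi fun _ : ℕ => betaMeasure 1 ϑ)
    hmp.measurable.aemeasurable (f := fun x => (1 - x) ^ tailExponent k b j)
    (Continuous.aestronglyMeasurable (by fun_prop))
  rw [hmp.map_eq] at h2
  exact h2.symm

theorem measurableSet_residual_nonneg :
    MeasurableSet {x : ℕ → ℝ | ∀ i, 0 ≤ x i ∧ 0 ≤ residual i x} := by
  have h3 : {x : ℕ → ℝ | ∀ i, 0 ≤ x i ∧ 0 ≤ residual i x} =
      ⋂ i, {x : ℕ → ℝ | 0 ≤ x i} ∩ {x : ℕ → ℝ | 0 ≤ residual i x} := by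
    ext; simp
  rw [h3]
  exact MeasurableSet.iInter fun i =>
    (measurableSet_le measurable_const (measurable_pi_apply i)).inter
      (measurableSet_le measurable_const (residual i).continuous.measurable)

/-- Under the GEM distribution, almost every sequence has nonnegative entries and nonnegative
residuals. -/
theorem gem_ae {ϑ : ℝ} (hϑ : 0 < ϑ) :
    ∀ᵐ x ∂(gem ϑ hϑ : Measure (ℕ → ℝ)), ∀ i, 0 ≤ x i ∧ 0 ≤ residual i x := by
  have := isProbabilityMeasureBeta one_pos hϑ
  change ∀ᵐ x ∂(Measure.map stickBreaking (Measure.infinitePi fun _ : ℕ => betaMeasure 1 ϑ)), _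
  rw [ae_map_iff measurable_stickBreaking.aemeasurable]
  · have h1 : ∀ᵐ x ∂(Measure.infinitePi fun _ : ℕ => betaMeasure 1 ϑ),
        ∀ i : ℕ, x i ∈ Set.Icc (0 : ℝ) 1 := by
      rw [ae_all_iff]
      intro i
      exact (measurePreserving_eval_infinitePi (fun _ : ℕ => betaMeasure 1 ϑ)
        i).quasiMeasurePreserving.ae (betaMeasure_ae_mem ϑ)
    filter_upwards [h1] with x hx i
    have h2 : 0 ≤ ∏ j ∈ Finset.range i, (1 - x j) :=
      Finset.prod_nonneg fun j _ => by linarith [(hx j).2]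
    exact ⟨mul_nonneg h2 (hx i).1, by rwa [residual_stickBreaking]⟩
  · exact measurableSet_residual_nonneg

theorem mem_Icc_of_residual_nonneg {x : ℕ → ℝ} (hx : ∀ i, 0 ≤ x i ∧ 0 ≤ residual i x) (i : ℕ) :
    x i ∈ Set.Icc (0 : ℝ) 1 := by
  refine ⟨(hx i).1, ?_⟩
  have h1 := (hx (i + 1)).2
  have h2 : x i ≤ ∑ j ∈ Finset.range (i + 1), x j :=
    Finset.single_le_sum (fun j _ => (hx j).1) (Finset.self_mem_range_succ i)
  rw [residual_apply] at h1
  linarith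

theorem residual_ageOrderedLengths_nonneg {n : ℕ} (σ : Equiv.Perm (Fin n)) (i : ℕ) :
    0 ≤ ageOrderedLengths σ i ∧ 0 ≤ residual i (ageOrderedLengths σ) := by
  constructor
  · rw [ageOrderedLengths_eq]
    positivity
  · rcases n.eq_zero_or_pos with rfl | hn
    · simp [residual_apply, ageOrderedLengths_eq]
    · rw [residual_ageOrderedLengths hn]
      have h1 : ((ageLengths σ).take i).sum ≤ n :=
        ((List.take_sublist i _).sum_le_sum fun _ _ => Nat.zero_le _).trans_eq (sum_ageLengths σ)
      have h2 : (((ageLengths σ).take i).sum : ℝ) ≤ n := by exact_mod_cast h1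
      exact div_nonneg (by linarith) n.cast_nonneg

theorem ae_map_P {E : Type*} [MeasurableSpace E] (θ : ℕ → ℝ≥0) (n : ℕ)
    (g : Equiv.Perm (Fin n) → E) {p : E → Prop} (hp : MeasurableSet {x | p x}) (h : ∀ σ, p (g σ)) :
    ∀ᵐ x ∂((P θ n).map g : Measure E), p x := by
  rw [FiniteMeasure.toMeasure_map, ae_map_iff measurable_from_top.aemeasurable hp]
  exact Eventually.of_forall h

theorem measurableSet_cube : MeasurableSet {x : ℕ → ℝ | ∀ i, x i ∈ Set.Icc (0 : ℝ) 1} := by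
  have h : {x : ℕ → ℝ | ∀ i, x i ∈ Set.Icc (0 : ℝ) 1} =
      ⋂ i, (fun x : ℕ → ℝ => x i) ⁻¹' Set.Icc (0 : ℝ) 1 := by
    ext; simp
  rw [h]
  exact MeasurableSet.iInter fun i => measurableSet_Icc.preimage (measurable_pi_apply i)

theorem tendsto_ageOrderedLengths {θ : ℕ → ℝ≥0} {θlim : ℝ} (hpos : 0 < θlim)
    (hw : ConvergentWeights (fun j => (θ j : ℝ)) θlim) :
    Tendsto (fun n => (P θ n).map ageOrderedLengths) atTop
      (𝓝 (gem θlim hpos).toFiniteMeasure) := by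
  refine tendsto_of_tendsto_integral_prod residual ?_ ?_ ?_ ?_
  · intro x y hxy
    ext i
    rw [eq_residual_sub x i, eq_residual_sub y i, hxy, hxy]
  · intro n
    exact ae_map_P _ _ _ measurableSet_cube fun σ =>
      mem_Icc_of_residual_nonneg (residual_ageOrderedLengths_nonneg σ)
  · change ∀ᵐ x ∂(gem θlim hpos : Measure (ℕ → ℝ)), _
    filter_upwards [gem_ae hpos] with x hx using mem_Icc_of_residual_nonneg hx
  · intro L
    simp only [prod_map_eq_prod_range]
    have h := integral_residual_gem hpos (L.sum + 1) fun i => L.count i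
    change Tendsto _ atTop (𝓝 (∫ x, _ ∂(gem θlim hpos : Measure (ℕ → ℝ))))
    rw [h]
    refine (tendsto_integral_residual hw (L.sum + 1) fun i => L.count i).congr fun n => ?_
    rw [integral_map_P]
    exact Continuous.stronglyMeasurable (by fun_prop)

/-! ### The nonincreasing rearrangement of the cycle lengths -/

theorem nonempty_finset_card (k : ℕ) : Nonempty {S : Finset ℕ // S.card = k + 1} :=
  ⟨⟨Finset.range (k + 1), Finset.card_range _⟩⟩

theorem ranked_le_ranked_add {u v : ℕ → ℝ} {ε : ℝ} (hv : BddAbove (Set.range v))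
    (h : ∀ i, u i ≤ v i + ε) (k : ℕ) : ranked u k ≤ ranked v k + ε := by
  have := nonempty_finset_card k
  obtain ⟨M, hM⟩ := hv
  refine ciSup_le fun S => ?_
  rw [← sub_le_iff_le_add]
  have hne : S.1.Nonempty := Finset.card_pos.mp (by rw [S.2]; exact k.succ_pos)
  refine le_ciSup_of_le ⟨M, ?_⟩ S ?_
  · rintro _ ⟨T, rfl⟩
    have hT : T.1.Nonempty := Finset.card_pos.mp (by rw [T.2]; exact k.succ_pos)
    obtain ⟨i, hi⟩ := hT
    exact (Finset.inf'_le _ hi).trans (hM ⟨i, rfl⟩)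
  · refine Finset.le_inf' _ _ fun i hi => ?_
    rw [sub_le_iff_le_add]
    exact (Finset.inf'_le _ hi).trans (h i)

theorem bddAbove_of_mem_Icc {u : ℕ → ℝ} (hu : ∀ i, u i ∈ Set.Icc (0 : ℝ) 1) :
    BddAbove (Set.range u) :=
  ⟨1, by rintro _ ⟨i, rfl⟩; exact (hu i).2⟩

theorem abs_ranked_sub_le {u v : ℕ → ℝ} {ε : ℝ} (hu : ∀ i, u i ∈ Set.Icc (0 : ℝ) 1)
    (hv : ∀ i, v i ∈ Set.Icc (0 : ℝ) 1) (h : ∀ i, |u i - v i| ≤ ε) (k : ℕ) :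
    |ranked u k - ranked v k| ≤ ε := by
  have h1 := ranked_le_ranked_add (u := u) (ε := ε) (bddAbove_of_mem_Icc hv)
    (fun i => by linarith [(abs_le.1 (h i)).2]) k
  have h2 := ranked_le_ranked_add (u := v) (ε := ε) (bddAbove_of_mem_Icc hu)
    (fun i => by linarith [(abs_le.1 (h i)).1]) k
  exact abs_le.2 ⟨by linarith, by linarith⟩

theorem ranked_mem_Icc {u : ℕ → ℝ} (hu : ∀ i, u i ∈ Set.Icc (0 : ℝ) 1) (k : ℕ) :
    ranked u k ∈ Set.Icc (0 : ℝ) 1 := by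
  have := nonempty_finset_card k
  have hle : ∀ S : {S : Finset ℕ // S.card = k + 1},
      S.1.inf' (Finset.card_pos.mp (by rw [S.2]; exact k.succ_pos)) u ≤ 1 := by
    intro S
    have hS : S.1.Nonempty := Finset.card_pos.mp (by rw [S.2]; exact k.succ_pos)
    obtain ⟨i, hi⟩ := hS
    exact (Finset.inf'_le _ hi).trans (hu i).2
  exact ⟨Real.iSup_nonneg fun S => Finset.le_inf' _ _ fun i _ => (hu i).1, ciSup_le hle⟩

/-- The first `N` entries of a sequence, forced into the unit interval and continued by zeros. -/
noncomputable def clampInit (N : ℕ) (x : ℕ → ℝ) : ℕ → ℝ :=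
  fun i => if i < N then max 0 (min 1 (x i)) else 0

theorem clampInit_mem_Icc (N : ℕ) (x : ℕ → ℝ) (i : ℕ) : clampInit N x i ∈ Set.Icc (0 : ℝ) 1 := by
  unfold clampInit
  split_ifs
  · exact ⟨le_max_left _ _, max_le zero_le_one (min_le_left _ _)⟩
  · exact ⟨le_rfl, zero_le_one⟩

theorem continuous_ranked_clampInit (N k : ℕ) : Continuous fun x => ranked (clampInit N x) k := by
  rw [continuous_iff_continuousAt]
  intro x
  refine Metric.tendsto_nhds.2 fun ε hε => ?_
  have h1 : ∀ i ∈ Finset.range N, ∀ᶠ y in 𝓝 x, |clampInit N y i - clampInit N x i| < ε / 2 := by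
    intro i hi
    have hc : Continuous fun y : ℕ → ℝ => clampInit N y i := by
      simp only [clampInit, if_pos (Finset.mem_range.1 hi)]
      fun_prop
    exact Metric.tendsto_nhds.1 hc.continuousAt (ε / 2) (half_pos hε)
  filter_upwards [(Filter.eventually_all_finset _).2 h1] with y hy
  rw [Real.dist_eq]
  refine (abs_ranked_sub_le (clampInit_mem_Icc N y) (clampInit_mem_Icc N x) (fun i => ?_) k).trans_lt
    (half_lt_self hε)
  by_cases hi : i < N
  · exact (hy i (Finset.mem_range.2 hi)).le
  · simp only [clampInit, if_neg hi, sub_self, abs_zero]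
    exact (half_pos hε).le

theorem residual_antitone {x : ℕ → ℝ} (hx : ∀ i, 0 ≤ x i) : Antitone fun i => residual i x :=
  antitone_nat_of_succ_le fun i => by linarith [eq_residual_sub x i, hx i]

theorem abs_sub_clampInit_le {x : ℕ → ℝ} (hx : ∀ i, 0 ≤ x i ∧ 0 ≤ residual i x) (N i : ℕ) :
    |x i - clampInit N x i| ≤ residual N x := by
  have hm := mem_Icc_of_residual_nonneg hx i
  by_cases hi : i < N
  · rw [clampInit, if_pos hi, min_eq_right hm.2, max_eq_right hm.1, sub_self, abs_zero]
    exact (hx N).2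
  · rw [clampInit, if_neg hi, sub_zero, abs_of_nonneg hm.1]
    have h1 := residual_antitone (fun i => (hx i).1) (not_lt.1 hi)
    simp only at h1
    linarith [eq_residual_sub x i, (hx (i + 1)).2]

theorem prod_map_mem_Icc {f : ℕ → ℝ} (hf : ∀ i, f i ∈ Set.Icc (0 : ℝ) 1) (L : List ℕ) :
    (L.map f).prod ∈ Set.Icc (0 : ℝ) 1 := by
  induction L with
  | nil => simp
  | cons a L ih =>
    rw [List.map_cons, List.prod_cons]
    exact ⟨mul_nonneg (hf a).1 ih.1, mul_le_one₀ (hf a).2 ih.1 ih.2⟩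

theorem abs_prod_map_sub_le {f g : ℕ → ℝ} (hf : ∀ i, f i ∈ Set.Icc (0 : ℝ) 1)
    (hg : ∀ i, g i ∈ Set.Icc (0 : ℝ) 1) {ε : ℝ} (h : ∀ i, |f i - g i| ≤ ε) (L : List ℕ) :
    |(L.map f).prod - (L.map g).prod| ≤ L.length * ε := by
  induction L with
  | nil => simp
  | cons a L ih =>
    simp only [List.map_cons, List.prod_cons, List.length_cons]
    have hF := prod_map_mem_Icc hf L
    calc |f a * (L.map f).prod - g a * (L.map g).prod|
        = |(f a - g a) * (L.map f).prod + g a * ((L.map f).prod - (L.map g).prod)| := by ring_nf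
      _ ≤ |f a - g a| * (L.map f).prod + g a * |(L.map f).prod - (L.map g).prod| := by
          refine (abs_add_le _ _).trans_eq ?_
          rw [abs_mul, abs_mul, abs_of_nonneg hF.1, abs_of_nonneg (hg a).1]
      _ ≤ ε * 1 + 1 * (L.length * ε) := by
          have hε : 0 ≤ ε := (abs_nonneg _).trans (h a)
          exact add_le_add (mul_le_mul (h a) hF.2 hF.1 hε)
            (mul_le_mul (hg a).2 ih (abs_nonneg _) zero_le_one)
      _ = _ := by push_cast; ring

theorem measurable_prod_map {α : Type*} [MeasurableSpace α] {f : ℕ → α → ℝ}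
    (hf : ∀ i, Measurable (f i)) (L : List ℕ) : Measurable fun x => (L.map fun i => f i x).prod := by
  induction L with
  | nil => simp
  | cons a L ih =>
    simp only [List.map_cons, List.prod_cons]
    exact (hf a).mul ih

theorem continuous_prod_map {f : ℕ → (ℕ → ℝ) → ℝ} (hf : ∀ i, Continuous (f i)) (L : List ℕ) :
    Continuous fun x => (L.map fun i => f i x).prod := by
  induction L with
  | nil => simpa using continuous_const
  | cons a L ih =>
    simp only [List.map_cons, List.prod_cons]
    exact (hf a).mul ih

/-- Rearranging only the first `N` entries changes the moments of the nonincreasing rearrangement by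
at most a multiple of the mean of the `N`-th residual. -/
theorem abs_integral_ranked_sub_le {ρ : Measure (ℕ → ℝ)} [IsFiniteMeasure ρ]
    (hρ : ∀ᵐ x ∂ρ, ∀ i, 0 ≤ x i ∧ 0 ≤ residual i x) (N : ℕ) (L : List ℕ) :
    |∫ x, (L.map fun i => ranked x i).prod ∂ρ -
      ∫ x, (L.map fun i => ranked (clampInit N x) i).prod ∂ρ| ≤
      L.length * ∫ x, residual N x ∂ρ := by
  have h1 : Integrable (fun x => (L.map fun i => ranked x i).prod) ρ := by
    refine Integrable.of_bound (measurable_prod_map (fun i =>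
      (measurable_pi_apply i).comp measurable_ranked) L).aestronglyMeasurable 1 ?_
    filter_upwards [hρ] with x hx
    have := prod_map_mem_Icc (ranked_mem_Icc (mem_Icc_of_residual_nonneg hx)) L
    rw [Real.norm_of_nonneg this.1]
    exact this.2
  have h2 : Integrable (fun x => (L.map fun i => ranked (clampInit N x) i).prod) ρ := by
    refine Integrable.of_bound (continuous_prod_map (continuous_ranked_clampInit N)
      L).aestronglyMeasurable 1 (Eventually.of_forall fun x => ?_)
    have := prod_map_mem_Icc (ranked_mem_Icc (clampInit_mem_Icc N x)) L
    rw [Real.norm_of_nonneg this.1]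
    exact this.2
  have h3 : Integrable (fun x => residual N x) ρ := by
    refine Integrable.of_bound (residual N).continuous.aestronglyMeasurable 1 ?_
    filter_upwards [hρ] with x hx
    rw [Real.norm_of_nonneg (hx N).2]
    have := residual_antitone (fun i => (hx i).1) (Nat.zero_le N)
    simpa [residual_apply] using this
  rw [← integral_sub h1 h2, ← integral_const_mul]
  refine (abs_integral_le_integral_abs).trans
    (integral_mono_ae (h1.sub h2).abs (h3.const_mul _) ?_)
  filter_upwards [hρ] with x hx
  have hm := mem_Icc_of_residual_nonneg hx
  exact abs_prod_map_sub_le (ranked_mem_Icc hm) (ranked_mem_Icc (clampInit_mem_Icc N x))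
    (abs_ranked_sub_le hm (clampInit_mem_Icc N x) (abs_sub_clampInit_le hx N)) L

theorem gemMoment_single (ϑ : ℝ) (hϑ : 0 < ϑ) (N : ℕ) :
    gemMoment ϑ (N + 1) (fun i => if i = N then 1 else 0) = (ϑ / (ϑ + 1)) ^ N := by
  have h1 : ∀ j, tailExponent (N + 1) (fun i => if i = N then 1 else 0) j =
      if j < N then 1 else 0 := by
    intro j
    unfold tailExponent
    rw [Finset.sum_eq_single N]
    · simp
    · intro i _ hi
      simp [hi]
    · simp
  rw [gemMoment, Finset.prod_range_succ, h1, if_neg (lt_irrefl N)]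
  simp only [h1]
  rw [Finset.prod_congr rfl (g := fun _ => ϑ / (ϑ + 1))
    (fun j hj => by rw [if_pos (Finset.mem_range.1 hj), Nat.cast_one])]
  rw [Finset.prod_const, Finset.card_range]
  simp [hϑ.ne']

theorem prod_pow_single (f : ℕ → ℝ) (N : ℕ) :
    ∏ i ∈ Finset.range (N + 1), f i ^ (if i = N then 1 else 0) = f N := by
  rw [Finset.prod_range_succ, if_pos rfl, pow_one, Finset.prod_eq_one, one_mul]
  intro i hi
  rw [if_neg (Finset.mem_range.1 hi).ne, pow_zero]

/-- The moments of the rearrangement converge: both sides are compared with the rearrangement of the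
first `N` entries, which is continuous. -/
theorem tendsto_integral_ranked {θ : ℕ → ℝ≥0} {θlim : ℝ} (hpos : 0 < θlim)
    (hw : ConvergentWeights (fun j => (θ j : ℝ)) θlim) (L : List ℕ) :
    Tendsto (fun n => ∫ x, (L.map fun i => ranked x i).prod
        ∂((P θ n).map ageOrderedLengths : Measure (ℕ → ℝ))) atTop
      (𝓝 (∫ x, (L.map fun i => ranked x i).prod ∂(gem θlim hpos : Measure (ℕ → ℝ)))) := by
  set r := θlim / (θlim + 1) with hr
  have hr0 : 0 ≤ r := by positivity
  have hr1 : r < 1 := by rw [hr, div_lt_one (by positivity)]; linarith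
  rw [Metric.tendsto_atTop']
  intro ε hε
  have hLr : Tendsto (fun N => (L.length : ℝ) * r ^ N) atTop (𝓝 0) := by
    simpa using (tendsto_pow_atTop_nhds_zero_of_lt_one hr0 hr1).const_mul (L.length : ℝ)
  obtain ⟨N, hN⟩ := (hLr.eventually (gt_mem_nhds (by positivity : 0 < ε / 3))).exists
  have hres : Tendsto (fun n => L.length * ∫ x, residual N x
      ∂((P θ n).map ageOrderedLengths : Measure (ℕ → ℝ))) atTop (𝓝 (L.length * r ^ N)) := by
    have h := tendsto_integral_residual hw (N + 1) fun i => if i = N then 1 else 0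
    rw [gemMoment_single _ hpos] at h
    refine (h.congr fun n => ?_).const_mul _
    rw [integral_map_P _ _ _ (residual N).continuous.stronglyMeasurable]
    simp only [prod_pow_single fun i => residual i (ageOrderedLengths _)]
  have hgem : ∫ x, residual N x ∂(gem θlim hpos : Measure (ℕ → ℝ)) = r ^ N := by
    rw [hr, ← gemMoment_single _ hpos, ← integral_residual_gem hpos]
    simp only [prod_pow_single fun i => residual i _]
  let G : BoundedContinuousFunction (ℕ → ℝ) ℝ := BoundedContinuousFunction.ofNormedAddCommGroup
    (fun x => (L.map fun i => ranked (clampInit N x) i).prod)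
    (continuous_prod_map (continuous_ranked_clampInit N) L) 1 fun x => by
      have := prod_map_mem_Icc (ranked_mem_Icc (clampInit_mem_Icc N x)) L
      rw [Real.norm_of_nonneg this.1]
      exact this.2
  have hG := (FiniteMeasure.tendsto_iff_forall_integral_tendsto.1
    (tendsto_ageOrderedLengths hpos hw)) G
  change Tendsto _ _ (𝓝 (∫ x, (L.map fun i => ranked (clampInit N x) i).prod
    ∂(gem θlim hpos : Measure (ℕ → ℝ)))) at hG
  have hb := abs_integral_ranked_sub_le (gem_ae hpos) N L
  rw [hgem] at hb
  obtain ⟨n₀, hn₀⟩ := eventually_atTop.1 ((hres.eventually (gt_mem_nhds hN)).and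
    (hG.eventually (Metric.ball_mem_nhds _ (by positivity : 0 < ε / 3))))
  refine ⟨n₀, fun n hn => ?_⟩
  obtain ⟨h1, h2⟩ := hn₀ n hn.le
  have h3 := abs_integral_ranked_sub_le (ρ := ((P θ n).map ageOrderedLengths : Measure (ℕ → ℝ)))
    (ae_map_P _ _ _ measurableSet_residual_nonneg residual_ageOrderedLengths_nonneg) N L
  change dist (∫ x, (L.map fun i => ranked (clampInit N x) i).prod
    ∂((P θ n).map ageOrderedLengths : Measure (ℕ → ℝ))) _ < _ at h2
  rw [Real.dist_eq] at h2 ⊢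
  rw [abs_le] at h3 hb
  rw [abs_lt] at h2 ⊢
  constructor <;> linarith

theorem tendsto_rankedLengths {θ : ℕ → ℝ≥0} {θlim : ℝ} (hpos : 0 < θlim)
    (hw : ConvergentWeights (fun j => (θ j : ℝ)) θlim) :
    Tendsto (fun n => (P θ n).map rankedLengths) atTop
      (𝓝 (poissonDirichlet θlim hpos).toFiniteMeasure) := by
  have hmeas : ∀ L : List ℕ, StronglyMeasurable fun x : ℕ → ℝ => (L.map fun i => x i).prod :=
    fun L => (measurable_prod_map measurable_pi_apply L).stronglyMeasurable
  refine tendsto_of_tendsto_integral_prod (fun i => ⟨fun x => x i, continuous_apply i⟩) ?_ ?_ ?_ ?_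
  · exact fun x y hxy => funext hxy
  · intro n
    refine ae_map_P _ _ _ measurableSet_cube fun σ => ?_
    rw [rankedLengths_eq_ranked]
    exact ranked_mem_Icc (mem_Icc_of_residual_nonneg (residual_ageOrderedLengths_nonneg σ))
  · change ∀ᵐ x ∂(Measure.map ranked (gem θlim hpos : Measure (ℕ → ℝ))), _
    rw [ae_map_iff measurable_ranked.aemeasurable measurableSet_cube]
    filter_upwards [gem_ae hpos] with x hx using ranked_mem_Icc (mem_Icc_of_residual_nonneg hx)
  · intro L
    have h1 : ∫ x, (L.map fun i => x i).prod ∂(poissonDirichlet θlim hpos : Measure (ℕ → ℝ)) =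
        ∫ x, (L.map fun i => ranked x i).prod ∂(gem θlim hpos : Measure (ℕ → ℝ)) :=
      integral_map measurable_ranked.aemeasurable (hmeas L).aestronglyMeasurable
    change Tendsto _ _ (𝓝 (∫ x, (L.map fun i => x i).prod
      ∂(poissonDirichlet θlim hpos : Measure (ℕ → ℝ))))
    rw [h1]
    refine (tendsto_integral_ranked hpos hw L).congr fun n => ?_
    have h2 := integral_map_P θ n rankedLengths (hmeas L)
    have h3 := integral_map_P θ n ageOrderedLengths (measurable_prod_map (fun i =>
      (measurable_pi_apply i).comp measurable_ranked) L).stronglyMeasurable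
    refine Eq.trans ?_ h2.symm
    simp only [rankedLengths_eq_ranked]
    exact h3

end WeightedPerm

theorem mainTheorem1 (θ : ℕ → ℝ≥0) (θlim : ℝ) (hpos : 0 < θlim)
    (hlim : Tendsto (fun j => (θ j : ℝ)) atTop (𝓝 θlim)) :
    (∀ᶠ n in atTop, 0 < WeightedPerm.h θ n) ∧
    Tendsto (fun n => (WeightedPerm.P θ n).map WeightedPerm.cycleCounts) atTop
      (𝓝 (WeightedPerm.poissonLaw θ).toFiniteMeasure) ∧
    Tendsto (fun n : ℕ =>
        (∫ σ, (WeightedPerm.K σ : ℝ) ∂(WeightedPerm.P θ n : Measure (Equiv.Perm (Fin n)))) /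
          Real.log n) atTop (𝓝 θlim) ∧
    Tendsto (fun n => (WeightedPerm.P θ n).map WeightedPerm.ageOrderedLengths) atTop
      (𝓝 (WeightedPerm.gem θlim hpos).toFiniteMeasure) ∧
    Tendsto (fun n => (WeightedPerm.P θ n).map WeightedPerm.rankedLengths) atTop
      (𝓝 (WeightedPerm.poissonDirichlet θlim hpos).toFiniteMeasure) := by
  have hw := WeightedPerm.ConvergentWeights.of_nnreal hpos hlim
  exact ⟨WeightedPerm.eventually_h_pos hw, WeightedPerm.tendsto_cycleCounts hw,
    WeightedPerm.tendsto_mean_K hw, WeightedPerm.tendsto_ageOrderedLengths hpos hw,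
    WeightedPerm.tendsto_rankedLengths hpos hw⟩
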